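/- Consider $\mathsf{PCFL}_\oplus$, the simply typed call-by-value $\lambda$-calculus with types $\sigma,\tau ::= \mathbf{bool}\mid\mathbf{int}\mid\sigma\to\tau\mid\sigma\times\tau\mid[\sigma]$, numerals $\underline n$ ($n\in\mathbb N$), booleans, lazy pairs with projections, lazy lists with $\mathsf{nil}$, cons and a case destructor, conditionals, a finite set of binary arithmetic operators on $\mathbb N$ (with results in $\mathbb N$ or the booleans) containing at least $+$, $\le$ and $=$, recursion $\mathsf{fix}\,x.M$ at function types, and fair probabilistic choice $M\oplus N$. Terms are taken modulo $\alpha$-equivalence. Values are numerals, booleans, $\mathsf{nil}$, abstractions, terms $\mathsf{fix}\,x.M$, pairs and conses. For a closed term $M$, $[\![M]\!]$ is the supremum of the finite value distributions $\mathscr D$ with $M\Downarrow\mathscr D$ in the big-step approximation semantics, and $\sum[\![M]\!]$ is its probability of convergence. The contextual preorder $\Gamma\vdash M\le N:\tau$ holds, for $M,N$ of type $\tau$ in the typing context $\Gamma$, if $\sum[\![C[M]]\!]\le\sum[\![C[N]]\!]$ for every closing well-typed context $C$ whose hole accepts terms of type $\tau$ in $\Gamma$. A probabilistic simulation on a labelled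 Markov chain $(\mathcal S,\mathcal L,\mathcal P)$ is a preorder $R$ on $\mathcal S$ such that $s\,R\,t$ implies $\mathcal P(s,l,X)\le\mathcal P(t,l,R(X))$ for all $l\in\mathcal L$ and $X\subseteq\mathcal S$; similarity $\precsim$ is the union of all simulations. It is taken on the chain whose states are the pairs $(M,\sigma)$ with $M$ a closed term of type $\sigma$ and the pairs $(\hat V,\sigma)$ with $V$ a closed value of type $\sigma$, with the following transitions. $(M,\sigma)$ goes to $(\hat V,\sigma)$ under $\mathit{eval}$ with probability $[\![M]\!](V)$. Each state with type $\sigma$ goes to itself under the label $\sigma$ with probability $1$. With probability $1$ too, for every closed value $W$ of type $\tau$, $(\widehat{\lambda x.M},\tau\to\theta)$ goes under $W$ to $(M\{W/x\},\theta)$ and $(\widehat{\mathsf{fix}\,x.M},\tau\to\theta)$ goes under $W$ to $(M\{\mathsf{fix}\,x.M/x\}\,W,\theta)$; a pair goes to its components under $\mathit{fst}$, $\mathit{snd}$, a cons goes to its head and tail under $\mathit{hd}$, $\mathit{tl}$, and numerals, booleans and $\mathsf{nil}$ go to themselves under a label naming them. All other probabilities are $0$. The simulation preorder $\precsim_\circ$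 is the open extension of $\precsim$: $\Gamma\vdash M\precsim_\circ N:\sigma$ if $(M\xi,\sigma)\precsim(N\xi,\sigma)$ for every substitution $\xi$ of closed values of the right types for the variables of $\Gamma$. **Theorem.** The simulation preorder $\precsim_\circ$ is not fully abstract, i.e. it does not coincide with the contextual preorder $\le$. More precisely, let $\Omega=(\mathsf{fix}\,x.x)\,\underline 0$, $I=\lambda x.x$, $$M=\lambda x.\lambda y.(\Omega\oplus I),\qquad N=\lambda x.\big((\lambda y.\Omega)\oplus(\lambda y.I)\big),\qquad \sigma=\mathbf{bool}\to\mathbf{bool}\to\mathbf{bool}\to\mathbf{bool}.$$ Then $\emptyset\vdash M:\sigma$ and $\emptyset\vdash N:\sigma$; neither $\emptyset\vdash M\precsim_\circ N:\sigma$ nor $\emptyset\vdash N\precsim_\circ M:\sigma$; but $\emptyset\vdash M\le N:\sigma$. -/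

import Mathlib

open scoped ENNReal

namespace PCFL

/-! ### Types, operators and terms -/

/-- Types: `bool`, `int`, arrows, products and lists. -/
inductive Ty : Type
  | bool : Ty
  | int : Ty
  | arrow : Ty → Ty → Ty
  | prod : Ty → Ty → Ty
  | list : Ty → Ty

/-- A finite set of binary arithmetic operators on natural numbers, each of them with a result type
(`int` for `Sum.inl`, `bool` for `Sum.inr`) and a meaning. At least `+`, `≤` and `=` are present. -/
structure OpSig where
  Op : Type
  finite_Op : Finite Op
  interp : Op → (ℕ → ℕ → ℕ) ⊕ (ℕ → ℕ → Bool)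
  plus : Op
  le : Op
  eq : Op
  interp_plus : interp plus = Sum.inl (fun n m => n + m)
  interp_le : interp le = Sum.inr (fun n m => decide (n ≤ m))
  interp_eq : interp eq = Sum.inr (fun n m => decide (n = m))

/-- Terms modulo α-equivalence, in de Bruijn form: `lam` and `fix` bind the index `0` in their body,
and `lcase L M₁ M₂` (the list destructor) binds `0` (the head `h`) and `1` (the tail `t`) in `M₂`. -/
inductive Term (S : OpSig) : Type
  | var : ℕ → Term S
  | num : ℕ → Term S
  | bool : Bool → Term S
  | nil : Term S
  | pair : Term S → Term S → Term S
  | cons : Term S → Term S → Term S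
  | lam : Term S → Term S
  | fix : Term S → Term S
  | choice : Term S → Term S → Term S
  | ite : Term S → Term S → Term S → Term S
  | op : S.Op → Term S → Term S → Term S
  | fst : Term S → Term S
  | snd : Term S → Term S
  | lcase : Term S → Term S → Term S → Term S
  | app : Term S → Term S → Term S

variable {S : OpSig}

/-- Lifting of a renaming under one binder. -/
def upRen (ρ : ℕ → ℕ) : ℕ → ℕ
  | 0 => 0
  | n + 1 => ρ n + 1

/-- Renaming of the free variables. -/
def Term.rename : (ℕ → ℕ) → Term S → Term S
  | ρ, .var n => .var (ρ n)
  | _, .num n => .num n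
  | _, .bool b => .bool b
  | _, .nil => .nil
  | ρ, .pair M N => .pair (M.rename ρ) (N.rename ρ)
  | ρ, .cons M N => .cons (M.rename ρ) (N.rename ρ)
  | ρ, .lam M => .lam (M.rename (upRen ρ))
  | ρ, .fix M => .fix (M.rename (upRen ρ))
  | ρ, .choice M N => .choice (M.rename ρ) (N.rename ρ)
  | ρ, .ite L M N => .ite (L.rename ρ) (M.rename ρ) (N.rename ρ)
  | ρ, .op o M N => .op o (M.rename ρ) (N.rename ρ)
  | ρ, .fst M => .fst (M.rename ρ)
  | ρ, .snd M => .snd (M.rename ρ)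
  | ρ, .lcase L M N => .lcase (L.rename ρ) (M.rename ρ) (N.rename (upRen (upRen ρ)))
  | ρ, .app M N => .app (M.rename ρ) (N.rename ρ)

/-- The substitution sending `0` to `V` and `n + 1` to `s n`. -/
def scons (V : Term S) (s : ℕ → Term S) : ℕ → Term S
  | 0 => V
  | n + 1 => s n

/-- Lifting of a substitution under one binder. -/
def upSub (s : ℕ → Term S) : ℕ → Term S :=
  scons (.var 0) (fun n => (s n).rename Nat.succ)

/-- Capture-avoiding simultaneous substitution. -/
def Term.subst : (ℕ → Term S) → Term S → Term S
  | s, .var n => s n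
  | _, .num n => .num n
  | _, .bool b => .bool b
  | _, .nil => .nil
  | s, .pair M N => .pair (M.subst s) (N.subst s)
  | s, .cons M N => .cons (M.subst s) (N.subst s)
  | s, .lam M => .lam (M.subst (upSub s))
  | s, .fix M => .fix (M.subst (upSub s))
  | s, .choice M N => .choice (M.subst s) (N.subst s)
  | s, .ite L M N => .ite (L.subst s) (M.subst s) (N.subst s)
  | s, .op o M N => .op o (M.subst s) (N.subst s)
  | s, .fst M => .fst (M.subst s)
  | s, .snd M => .snd (M.subst s)
  | s, .lcase L M N => .lcase (L.subst s) (M.subst s) (N.subst (upSub (upSub s)))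
  | s, .app M N => .app (M.subst s) (N.subst s)

/-- `M{N/x}`, where `x` is the variable `0` of `M`. -/
def Term.inst (M N : Term S) : Term S :=
  M.subst (scons N .var)

/-- `M{V/h, W/t}`, where `h`, `t` are the variables `0`, `1` of `M`. -/
def Term.inst₂ (M V W : Term S) : Term S :=
  M.subst (scons V (scons W .var))

/-- The result type `γ_op` of an operator. -/
def resTy (o : S.Op) : Ty :=
  match S.interp o with
  | .inl _ => .int
  | .inr _ => .bool

/-- The constant denoting the value of an operator at two numbers. -/
def opConst (o : S.Op) (n m : ℕ) : Term S :=
  match S.interp o with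
  | .inl f => .num (f n m)
  | .inr f => .bool (f n m)

/-- The typing judgement `Γ ⊢ M : σ`; the variable `i` has the `i`-th type of the list `Γ`. -/
inductive Typed : List Ty → Term S → Ty → Prop
  | var {Γ i σ} : Γ[i]? = some σ → Typed Γ (.var i) σ
  | num {Γ n} : Typed Γ (.num n) .int
  | bool {Γ b} : Typed Γ (.bool b) .bool
  | nil {Γ σ} : Typed Γ .nil (.list σ)
  | pair {Γ M N σ τ} : Typed Γ M σ → Typed Γ N τ → Typed Γ (.pair M N) (.prod σ τ)
  | cons {Γ M N σ} : Typed Γ M σ → Typed Γ N (.list σ) → Typed Γ (.cons M N) (.list σ)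
  | lam {Γ M σ τ} : Typed (σ :: Γ) M τ → Typed Γ (.lam M) (.arrow σ τ)
  | fix {Γ M σ τ} : Typed (.arrow σ τ :: Γ) M (.arrow σ τ) → Typed Γ (.fix M) (.arrow σ τ)
  | choice {Γ M N σ} : Typed Γ M σ → Typed Γ N σ → Typed Γ (.choice M N) σ
  | ite {Γ L M N σ} :
      Typed Γ L .bool → Typed Γ M σ → Typed Γ N σ → Typed Γ (.ite L M N) σ
  | op {Γ o M N} : Typed Γ M .int → Typed Γ N .int → Typed Γ (.op o M N) (resTy o)
  | fst {Γ M σ τ} : Typed Γ M (.prod σ τ) → Typed Γ (.fst M) σ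
  | snd {Γ M σ τ} : Typed Γ M (.prod σ τ) → Typed Γ (.snd M) τ
  | lcase {Γ L M N σ τ} : Typed Γ L (.list σ) → Typed Γ M τ →
      Typed (σ :: .list σ :: Γ) N τ → Typed Γ (.lcase L M N) τ
  | app {Γ M N σ τ} : Typed Γ M (.arrow σ τ) → Typed Γ N σ → Typed Γ (.app M N) τ

/-- Values; pairs and lists are lazy. -/
inductive IsValue : Term S → Prop
  | num (n) : IsValue (.num n)
  | bool (b) : IsValue (.bool b)
  | nil : IsValue .nil
  | lam (M) : IsValue (.lam M)
  | fix (M) : IsValue (.fix M)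
  | cons (M N) : IsValue (.cons M N)
  | pair (M N) : IsValue (.pair M N)

/-! ### Operational semantics -/

open Classical in
/-- The value distribution concentrated at `V`. -/
noncomputable def dirac (V : Term S) : Term S → ℝ≥0∞ :=
  fun W => if W = V then 1 else 0

/-- Big-step approximation semantics `M ⇓ 𝒟`. A value distribution is a function on terms that
vanishes outside the values; all the sums below have finitely many nonzero terms. -/
inductive BigStep : Term S → (Term S → ℝ≥0∞) → Prop
  | empty (M) : BigStep M (fun _ => 0)
  | value {V} : IsValue V → BigStep V (dirac V)
  | op {o M N D E} : BigStep M D → BigStep N E →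
      BigStep (.op o M N)
        (fun U => ∑' (n : ℕ) (m : ℕ), D (.num n) * E (.num m) * dirac (opConst o n m) U)
  | app {M N K F} {E G : Term S → Term S → Term S → ℝ≥0∞} :
      BigStep M K → BigStep N F →
      (∀ P V, K (.lam P) ≠ 0 → F V ≠ 0 → BigStep (P.inst V) (E P V)) →
      (∀ Q V, K (.fix Q) ≠ 0 → F V ≠ 0 → BigStep (.app (Q.inst (.fix Q)) V) (G Q V)) →
      BigStep (.app M N)
        (fun U => ∑' V, F V * ((∑' P, K (.lam P) * E P V U) + ∑' Q, K (.fix Q) * G Q V U))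
  | ite {L M N D E₁ E₂} : BigStep L D → BigStep M E₁ → BigStep N E₂ →
      BigStep (.ite L M N) (fun U => D (.bool true) * E₁ U + D (.bool false) * E₂ U)
  | lcase {L M N D E} {G K F : Term S → Term S → Term S → ℝ≥0∞} :
      BigStep L D → BigStep M E →
      (∀ H T, D (.cons H T) ≠ 0 → BigStep H (G H T)) →
      (∀ H T, D (.cons H T) ≠ 0 → BigStep T (K H T)) →
      (∀ H T V W, D (.cons H T) ≠ 0 → G H T V ≠ 0 → K H T W ≠ 0 →
        BigStep (N.inst₂ V W) (F V W)) →
      BigStep (.lcase L M N)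
        (fun U => D .nil * E U +
          ∑' (H) (T) (V) (W), D (.cons H T) * G H T V * K H T W * F V W U)
  | fst {M D} {E : Term S → Term S → ℝ≥0∞} : BigStep M D →
      (∀ P N, D (.pair P N) ≠ 0 → BigStep P (E P)) →
      BigStep (.fst M) (fun U => ∑' (P) (N), D (.pair P N) * E P U)
  | snd {M D} {E : Term S → Term S → ℝ≥0∞} : BigStep M D →
      (∀ P N, D (.pair P N) ≠ 0 → BigStep N (E N)) →
      BigStep (.snd M) (fun U => ∑' (P) (N), D (.pair P N) * E N U)
  | choice {M N D₁ D₂} : BigStep M D₁ → BigStep N D₂ →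
      BigStep (.choice M N) (fun U => 2⁻¹ * D₁ U + 2⁻¹ * D₂ U)

/-- The big-step semantics `⟦M⟧`: the (pointwise) supremum of all `𝒟` with `M ⇓ 𝒟`. -/
noncomputable def sem (M : Term S) : Term S → ℝ≥0∞ :=
  ⨆ (D : Term S → ℝ≥0∞) (_ : BigStep M D), D

/-- The probability of convergence `∑ ⟦M⟧`. -/
noncomputable def conv (M : Term S) : ℝ≥0∞ :=
  ∑' V, sem M V

/-! ### The contextual preorder -/

/-- Contexts: terms with a unique hole. -/
inductive Ctx (S : OpSig) : Type
  | hole : Ctx S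
  | lam : Ctx S → Ctx S
  | fix : Ctx S → Ctx S
  | appL : Ctx S → Term S → Ctx S
  | appR : Term S → Ctx S → Ctx S
  | choiceL : Ctx S → Term S → Ctx S
  | choiceR : Term S → Ctx S → Ctx S
  | opL : S.Op → Ctx S → Term S → Ctx S
  | opR : S.Op → Term S → Ctx S → Ctx S
  | pairL : Ctx S → Term S → Ctx S
  | pairR : Term S → Ctx S → Ctx S
  | fst : Ctx S → Ctx S
  | snd : Ctx S → Ctx S
  | consL : Ctx S → Term S → Ctx S
  | consR : Term S → Ctx S → Ctx S
  | ite₁ : Ctx S → Term S → Term S → Ctx S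
  | ite₂ : Term S → Ctx S → Term S → Ctx S
  | ite₃ : Term S → Term S → Ctx S → Ctx S
  | lcase₁ : Ctx S → Term S → Term S → Ctx S
  | lcase₂ : Term S → Ctx S → Term S → Ctx S
  | lcase₃ : Term S → Term S → Ctx S → Ctx S

/-- `C[M]`: the hole is replaced by `M`, whose free variables may be captured. -/
def Ctx.plug : Ctx S → Term S → Term S
  | .hole, M => M
  | .lam C, M => .lam (C.plug M)
  | .fix C, M => .fix (C.plug M)
  | .appL C N, M => .app (C.plug M) N
  | .appR N C, M => .app N (C.plug M)
  | .choiceL C N, M => .choice (C.plug M) N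
  | .choiceR N C, M => .choice N (C.plug M)
  | .opL o C N, M => .op o (C.plug M) N
  | .opR o N C, M => .op o N (C.plug M)
  | .pairL C N, M => .pair (C.plug M) N
  | .pairR N C, M => .pair N (C.plug M)
  | .fst C, M => .fst (C.plug M)
  | .snd C, M => .snd (C.plug M)
  | .consL C N, M => .cons (C.plug M) N
  | .consR N C, M => .cons N (C.plug M)
  | .ite₁ C N P, M => .ite (C.plug M) N P
  | .ite₂ L C P, M => .ite L (C.plug M) P
  | .ite₃ L N C, M => .ite L N (C.plug M)
  | .lcase₁ C N P, M => .lcase (C.plug M) N P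
  | .lcase₂ L C P, M => .lcase L (C.plug M) P
  | .lcase₃ L N C, M => .lcase L N (C.plug M)

/-- `CtxTyped Δ B Γ C τ`: filling the hole of `C` with a term of type `B` in the typing context `Δ`
gives a term of type `τ` in the typing context `Γ`. Here `Δ` lists all the variables that are
available at the hole, i.e. those of `Γ` and those bound by `C` on the way to the hole. -/
inductive CtxTyped (Δ : List Ty) (B : Ty) : List Ty → Ctx S → Ty → Prop
  | hole : CtxTyped Δ B Δ .hole B
  | lam {Γ C σ τ} : CtxTyped Δ B (σ :: Γ) C τ → CtxTyped Δ B Γ (.lam C) (.arrow σ τ)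
  | fix {Γ C σ τ} : CtxTyped Δ B (.arrow σ τ :: Γ) C (.arrow σ τ) →
      CtxTyped Δ B Γ (.fix C) (.arrow σ τ)
  | appL {Γ C N σ τ} : CtxTyped Δ B Γ C (.arrow σ τ) → Typed Γ N σ →
      CtxTyped Δ B Γ (.appL C N) τ
  | appR {Γ C N σ τ} : Typed Γ N (.arrow σ τ) → CtxTyped Δ B Γ C σ →
      CtxTyped Δ B Γ (.appR N C) τ
  | choiceL {Γ C N σ} : CtxTyped Δ B Γ C σ → Typed Γ N σ → CtxTyped Δ B Γ (.choiceL C N) σ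
  | choiceR {Γ C N σ} : Typed Γ N σ → CtxTyped Δ B Γ C σ → CtxTyped Δ B Γ (.choiceR N C) σ
  | opL {Γ C N o} : CtxTyped Δ B Γ C .int → Typed Γ N .int →
      CtxTyped Δ B Γ (.opL o C N) (resTy o)
  | opR {Γ C N o} : Typed Γ N .int → CtxTyped Δ B Γ C .int →
      CtxTyped Δ B Γ (.opR o N C) (resTy o)
  | pairL {Γ C N σ τ} : CtxTyped Δ B Γ C σ → Typed Γ N τ →
      CtxTyped Δ B Γ (.pairL C N) (.prod σ τ)
  | pairR {Γ C N σ τ} : Typed Γ N σ → CtxTyped Δ B Γ C τ →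
      CtxTyped Δ B Γ (.pairR N C) (.prod σ τ)
  | fst {Γ C σ τ} : CtxTyped Δ B Γ C (.prod σ τ) → CtxTyped Δ B Γ (.fst C) σ
  | snd {Γ C σ τ} : CtxTyped Δ B Γ C (.prod σ τ) → CtxTyped Δ B Γ (.snd C) τ
  | consL {Γ C N σ} : CtxTyped Δ B Γ C σ → Typed Γ N (.list σ) →
      CtxTyped Δ B Γ (.consL C N) (.list σ)
  | consR {Γ C N σ} : Typed Γ N σ → CtxTyped Δ B Γ C (.list σ) →
      CtxTyped Δ B Γ (.consR N C) (.list σ)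
  | ite₁ {Γ C N P σ} : CtxTyped Δ B Γ C .bool → Typed Γ N σ → Typed Γ P σ →
      CtxTyped Δ B Γ (.ite₁ C N P) σ
  | ite₂ {Γ L C P σ} : Typed Γ L .bool → CtxTyped Δ B Γ C σ → Typed Γ P σ →
      CtxTyped Δ B Γ (.ite₂ L C P) σ
  | ite₃ {Γ L N C σ} : Typed Γ L .bool → Typed Γ N σ → CtxTyped Δ B Γ C σ →
      CtxTyped Δ B Γ (.ite₃ L N C) σ
  | lcase₁ {Γ C N P σ τ} : CtxTyped Δ B Γ C (.list σ) → Typed Γ N τ →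
      Typed (σ :: .list σ :: Γ) P τ → CtxTyped Δ B Γ (.lcase₁ C N P) τ
  | lcase₂ {Γ L C P σ τ} : Typed Γ L (.list σ) → CtxTyped Δ B Γ C τ →
      Typed (σ :: .list σ :: Γ) P τ → CtxTyped Δ B Γ (.lcase₂ L C P) τ
  | lcase₃ {Γ L N C σ τ} : Typed Γ L (.list σ) → Typed Γ N τ →
      CtxTyped Δ B (σ :: .list σ :: Γ) C τ → CtxTyped Δ B Γ (.lcase₃ L N C) τ

/-- The contextual preorder `Γ ⊢ M ≤ N : τ`. At the hole of a closing context `C`, further variables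
than those of `Γ` may be in scope. With names, `M` is inserted as it stands; with indices, its
variables have to be renamed to those of the larger typing context `Δ`, by some injection `ρ`. -/
def CtxPreorder (Γ : List Ty) (τ : Ty) (M N : Term S) : Prop :=
  Typed Γ M τ ∧ Typed Γ N τ ∧
    ∀ (Δ : List Ty) (ρ : ℕ → ℕ), Function.Injective ρ →
      (∀ i σ, Γ[i]? = some σ → Δ[ρ i]? = some σ) →
      ∀ (C : Ctx S) (σ : Ty), CtxTyped Δ τ [] C σ →
        conv (C.plug (M.rename ρ)) ≤ conv (C.plug (N.rename ρ))

/-! ### Probabilistic simulation and the simulation preorder -/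

/-- Probabilistic simulations on a labelled Markov chain with transition probabilities `P`: the
preorders `R` such that `R s t` implies `P(s, l, X) ≤ P(t, l, R(X))` for all `l` and `X`. -/
structure IsProbSimulation {Q L : Type} (P : Q → L → Q → ℝ≥0∞) (R : Q → Q → Prop) : Prop where
  refl : ∀ s, R s s
  trans : ∀ s t u, R s t → R t u → R s u
  sim : ∀ s t, R s t → ∀ (l : L) (X : Set Q),
    ∑' x : X, P s l x ≤ ∑' y : {y | ∃ x ∈ X, R x y}, P t l y

/-- Probabilistic similarity: the union of all probabilistic simulations. -/
def ProbSimilar {Q L : Type} (P : Q → L → Q → ℝ≥0∞) (s t : Q) : Prop :=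
  ∃ R, IsProbSimulation P R ∧ R s t

/-- The states: closed typed terms `(M, σ)`, and, as a disjoint copy, closed typed values
`(V̂, σ)`. -/
inductive State (S : OpSig) : Type
  | tm (M : Term S) (σ : Ty) (h : Typed [] M σ) : State S
  | val (V : Term S) (σ : Ty) (hV : IsValue V) (h : Typed [] V σ) : State S

/-- The labels: values, types, numbers, booleans, and the actions below. -/
inductive Label (S : OpSig) : Type
  | val (V : Term S) (hV : IsValue V) : Label S
  | ty (σ : Ty) : Label S
  | num (n : ℕ) : Label S
  | bool (b : Bool) : Label S
  | nil : Label S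
  | hd : Label S
  | tl : Label S
  | fst : Label S
  | snd : Label S
  | eval : Label S

/-- The transitions of probability one (for all labels but `eval`). -/
inductive DetStep : State S → Label S → State S → Prop
  | tyTm {M σ h} : DetStep (.tm M σ h) (.ty σ) (.tm M σ h)
  | tyVal {V σ hV h} : DetStep (.val V σ hV h) (.ty σ) (.val V σ hV h)
  | lam {M W τ θ hV h hW h'} : Typed [] W τ →
      DetStep (.val (.lam M) (.arrow τ θ) hV h) (.val W hW) (.tm (M.inst W) θ h')
  | fix {M W τ θ hV h hW h'} : Typed [] W τ →
      DetStep (.val (.fix M) (.arrow τ θ) hV h) (.val W hW)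
        (.tm (.app (M.inst (.fix M)) W) θ h')
  | fst {M N τ θ hV h h'} : DetStep (.val (.pair M N) (.prod τ θ) hV h) .fst (.tm M τ h')
  | snd {M N τ θ hV h h'} : DetStep (.val (.pair M N) (.prod τ θ) hV h) .snd (.tm N θ h')
  | num {k hV h} : DetStep (.val (.num k) .int hV h) (.num k) (.val (.num k) .int hV h)
  | bool {b hV h} : DetStep (.val (.bool b) .bool hV h) (.bool b) (.val (.bool b) .bool hV h)
  | nil {τ hV h} : DetStep (.val .nil (.list τ) hV h) .nil (.val .nil (.list τ) hV h)
  | hd {M N τ hV h h'} : DetStep (.val (.cons M N) (.list τ) hV h) .hd (.tm M τ h')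
  | tl {M N τ hV h h'} : DetStep (.val (.cons M N) (.list τ) hV h) .tl (.tm N (.list τ) h')

open Classical in
/-- The transition probabilities of the labelled Markov chain of closed programs. -/
noncomputable def trans : State S → Label S → State S → ℝ≥0∞
  | .tm M σ _, .eval, .val V τ _ _ => if σ = τ then sem M V else 0
  | s, l, t => if DetStep s l t then 1 else 0

/-- Applicative similarity of closed terms of type `σ`. -/
def AppSimilar (σ : Ty) (M N : Term S) : Prop :=
  ∃ (hM : Typed [] M σ) (hN : Typed [] N σ), ProbSimilar trans (.tm M σ hM) (.tm N σ hN)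

/-- `ξ` is a `Γ`-closure: it sends the variables of `Γ` to closed values of their types. -/
def IsClosure (Γ : List Ty) (ξ : ℕ → Term S) : Prop :=
  ∀ i τ, Γ[i]? = some τ → IsValue (ξ i) ∧ Typed [] (ξ i) τ

/-- The simulation preorder: the open extension of applicative similarity. -/
def SimPreorder (Γ : List Ty) (σ : Ty) (M N : Term S) : Prop :=
  Typed Γ M σ ∧ Typed Γ N σ ∧
    ∀ ξ : ℕ → Term S, IsClosure Γ ξ → AppSimilar σ (M.subst ξ) (N.subst ξ)

/-! ### The two terms -/

/-- `Ω = (fix x. x) 0`. -/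
def Omega : Term S := .app (.fix (.var 0)) (.num 0)

/-- `I = λx. x`. -/
def I : Term S := .lam (.var 0)

/-- `M = λx. λy. (Ω ⊕ I)`. -/
def termM : Term S := .lam (.lam (.choice Omega I))

/-- `N = λx. ((λy. Ω) ⊕ (λy. I))`. -/
def termN : Term S := .lam (.choice (.lam Omega) (.lam I))

/-- `bool → bool → bool → bool`. -/
def tyMN : Ty := .arrow .bool (.arrow .bool (.arrow .bool .bool))

end PCFL

namespace PCFL

variable {S : OpSig}

/-! ### Substitution -/

/-! Both terms flip a coin whose bad outcome is divergence. `termN` flips it once, when its first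
argument arrives. `termM` flips afresh each time the resulting function is applied. A context that
never applies the function loses nothing with either term. One that applies it k ≥ 1 times survives
with probability 2^(-k) under `termM` but 1/2 under `termN`. Hence the contextual inequality.

To make this rigorous for every context, convergence is expressed through a stack machine
(`conv_eq_runLim`), and a context filled with a closed term is written as an open term T with that
term substituted (`CtxTyped.subst_plug_var`). The two instances of T run in lockstep, since the
substituted terms are lambdas and matter only when evaluated or applied (`step_subst`). Each
application of the original hole variable creates a new hole variable, which stands for `flipper` on
the left and for a flipped coin on the right. The invariant `run_leftHoles_le` bounds the left run
by an average of right runs over all coins, where a coin is fixed to `true` once the left side has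
survived an application of its function. Surviving costs the left a factor 1/2. On the right, the
outcomes where that coin is good have weight at least 1/2 (`half_mul_avg_set_le`).

Similarity separates the terms because it sees the value reached between the two applications.
Applied once, `termM` yields `flipper` with probability 1. Among the two values of `termN`,
`flipper` is not below the divergent one, and the other has mass only 1/2. Conversely `termN` may
yield `λy. I`, which returns `I` with probability 1 when applied, while `flipper` returns it with
probability 1/2. -/

theorem upSub_var : upSub (Term.var : ℕ → Term S) = Term.var := by
  funext n; cases n <;> rfl

theorem Term.subst_var (M : Term S) : M.subst Term.var = M := by
  induction M <;> simp_all [Term.subst, upSub_var]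

theorem upRen_comp (ρ ρ' : ℕ → ℕ) : upRen ρ' ∘ upRen ρ = upRen (ρ' ∘ ρ) := by
  funext n; cases n <;> rfl

theorem Term.rename_rename (M : Term S) (ρ ρ' : ℕ → ℕ) :
    (M.rename ρ).rename ρ' = M.rename (ρ' ∘ ρ) := by
  induction M generalizing ρ ρ' <;> simp_all [Term.rename, upRen_comp]

theorem upSub_comp_upRen (s : ℕ → Term S) (ρ : ℕ → ℕ) :
    upSub s ∘ upRen ρ = upSub (s ∘ ρ) := by
  funext n; cases n <;> rfl

theorem Term.subst_rename (M : Term S) (ρ : ℕ → ℕ) (s : ℕ → Term S) :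
    (M.rename ρ).subst s = M.subst (s ∘ ρ) := by
  induction M generalizing ρ s <;> simp_all [Term.rename, Term.subst, upSub_comp_upRen]

theorem rename_upSub (s : ℕ → Term S) (ρ : ℕ → ℕ) :
    (fun n => (upSub s n).rename (upRen ρ)) = upSub (fun n => (s n).rename ρ) := by
  funext n
  cases n with
  | zero => rfl
  | succ n =>
    simp only [upSub, scons, Term.rename_rename]
    rfl

theorem Term.rename_subst (M : Term S) (s : ℕ → Term S) (ρ : ℕ → ℕ) :
    (M.subst s).rename ρ = M.subst (fun n => (s n).rename ρ) := by
  induction M generalizing ρ s <;> simp_all [Term.rename, Term.subst, rename_upSub]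

theorem subst_upSub (s t : ℕ → Term S) :
    (fun n => (upSub s n).subst (upSub t)) = upSub (fun n => (s n).subst t) := by
  funext n
  cases n with
  | zero => rfl
  | succ n =>
    simp only [upSub, scons, Term.subst_rename, Term.rename_subst]
    rfl

theorem Term.subst_subst (M : Term S) (s t : ℕ → Term S) :
    (M.subst s).subst t = M.subst (fun n => (s n).subst t) := by
  induction M generalizing s t <;> simp_all [Term.subst, subst_upSub]

theorem subst_scons_rename (V : Term S) (s : ℕ → Term S) (n : ℕ) :
    ((s n).rename Nat.succ).subst (scons V Term.var) = s n := by
  rw [Term.subst_rename]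
  exact Term.subst_var _

theorem Term.subst_inst (M N : Term S) (s : ℕ → Term S) :
    (M.inst N).subst s = (M.subst (upSub s)).inst (N.subst s) := by
  simp only [Term.inst, Term.subst_subst]
  congr 1
  funext n
  cases n with
  | zero => rfl
  | succ n => exact (subst_scons_rename _ s n).symm

theorem Term.subst_inst₂ (M V W : Term S) (s : ℕ → Term S) :
    (M.inst₂ V W).subst s = (M.subst (upSub (upSub s))).inst₂ (V.subst s) (W.subst s) := by
  simp only [Term.inst₂, Term.subst_subst]
  congr 1
  funext n
  rcases n with _ | _ | n
  · rfl
  · rfl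
  · simp only [scons, upSub, Term.subst, Term.subst_rename]
    exact (Term.subst_var _).symm

/-! ### An abstract machine -/

/-- The frames of the evaluation stack. -/
inductive Frame (S : OpSig) : Type
  | appL : Term S → Frame S
  | appR : Term S → Frame S
  | opL : S.Op → Term S → Frame S
  | opR : S.Op → Term S → Frame S
  | ite : Term S → Term S → Frame S
  | fst : Frame S
  | snd : Frame S
  | lcase : Term S → Term S → Frame S
  | head : Term S → Term S → Frame S
  | tail : Term S → Term S → Frame S

/-- Capture-avoiding substitution in a frame. -/
def Frame.subst (s : ℕ → Term S) : Frame S → Frame S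
  | .appL N => .appL (N.subst s)
  | .appR V => .appR (V.subst s)
  | .opL o N => .opL o (N.subst s)
  | .opR o V => .opR o (V.subst s)
  | .ite M N => .ite (M.subst s) (N.subst s)
  | .fst => .fst
  | .snd => .snd
  | .lcase M N => .lcase (M.subst s) (N.subst (upSub (upSub s)))
  | .head T N => .head (T.subst s) (N.subst (upSub (upSub s)))
  | .tail V N => .tail (V.subst s) (N.subst (upSub (upSub s)))

theorem Frame.subst_subst (F : Frame S) (s t : ℕ → Term S) :
    (F.subst s).subst t = F.subst (fun n => (s n).subst t) := by
  cases F <;> simp [Frame.subst, Term.subst_subst, subst_upSub]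

/-- Machine configurations: `ev K M` evaluates `M` under the stack `K`, and `ret K V` returns the
value `V` to the stack `K`. -/
inductive Conf (S : OpSig) : Type
  | ev : List (Frame S) → Term S → Conf S
  | ret : List (Frame S) → Term S → Conf S

/-- Capture-avoiding substitution in a configuration. -/
def Conf.subst (s : ℕ → Term S) : Conf S → Conf S
  | .ev K M => .ev (K.map (Frame.subst s)) (M.subst s)
  | .ret K V => .ret (K.map (Frame.subst s)) (V.subst s)

/-- The outcome of a machine step. -/
inductive Outcome (S : OpSig) : Type
  | stuck : Outcome S
  | done : Term S → Outcome S
  | next : Conf S → Outcome S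
  | branch : Conf S → Conf S → Outcome S

/-- Capture-avoiding substitution in an outcome. -/
def Outcome.subst (s : ℕ → Term S) : Outcome S → Outcome S
  | .stuck => .stuck
  | .done V => .done (V.subst s)
  | .next c => .next (c.subst s)
  | .branch c d => .branch (c.subst s) (d.subst s)

/-- Application of a value to a value. -/
def applyStep (K : List (Frame S)) (W : Term S) : Term S → Outcome S
  | .lam P => .next (.ev K (P.inst W))
  | .fix Q => .next (.ev K (.app (Q.inst (.fix Q)) W))
  | _ => .stuck

/-- Application of an operator to two values. -/
def opStep (K : List (Frame S)) (o : S.Op) : Term S → Term S → Outcome S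
  | .num n, .num m => .next (.ret K (opConst o n m))
  | _, _ => .stuck

/-- Conditional on a value. -/
def iteStep (K : List (Frame S)) (M N : Term S) : Term S → Outcome S
  | .bool true => .next (.ev K M)
  | .bool false => .next (.ev K N)
  | _ => .stuck

/-- First projection of a value. -/
def fstStep (K : List (Frame S)) : Term S → Outcome S
  | .pair P _ => .next (.ev K P)
  | _ => .stuck

/-- Second projection of a value. -/
def sndStep (K : List (Frame S)) : Term S → Outcome S
  | .pair _ N => .next (.ev K N)
  | _ => .stuck

/-- Case analysis on a list value. -/
def lcaseStep (K : List (Frame S)) (M N : Term S) : Term S → Outcome S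
  | .nil => .next (.ev K M)
  | .cons H T => .next (.ev (.head T N :: K) H)
  | _ => .stuck

/-- Returning a value to a stack. -/
def retStep (V : Term S) : List (Frame S) → Outcome S
  | [] => .done V
  | .appL N :: K => .next (.ev (.appR V :: K) N)
  | .appR f :: K => applyStep K V f
  | .opL o N :: K => .next (.ev (.opR o V :: K) N)
  | .opR o W :: K => opStep K o W V
  | .ite M N :: K => iteStep K M N V
  | .fst :: K => fstStep K V
  | .snd :: K => sndStep K V
  | .lcase M N :: K => lcaseStep K M N V
  | .head T N :: K => .next (.ev (.tail V N :: K) T)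
  | .tail W N :: K => .next (.ev K (N.inst₂ W V))

/-- Evaluating a term under a stack. -/
def evStep (K : List (Frame S)) : Term S → Outcome S
  | .var _ => .stuck
  | .num n => .next (.ret K (.num n))
  | .bool b => .next (.ret K (.bool b))
  | .nil => .next (.ret K .nil)
  | .pair M N => .next (.ret K (.pair M N))
  | .cons M N => .next (.ret K (.cons M N))
  | .lam M => .next (.ret K (.lam M))
  | .fix M => .next (.ret K (.fix M))
  | .choice M N => .branch (.ev K M) (.ev K N)
  | .ite L M N => .next (.ev (.ite M N :: K) L)
  | .op o M N => .next (.ev (.opL o N :: K) M)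
  | .fst M => .next (.ev (.fst :: K) M)
  | .snd M => .next (.ev (.snd :: K) M)
  | .lcase L M N => .next (.ev (.lcase M N :: K) L)
  | .app M N => .next (.ev (.appL N :: K) M)

/-- The machine step. -/
def step : Conf S → Outcome S
  | .ev K M => evStep K M
  | .ret K V => retStep V K

/-- The expected value of `g` at the outcome of a step, where `φ` gives the reward of a result. -/
noncomputable def Outcome.expect (φ : Term S → ℝ≥0∞) (g : Conf S → ℝ≥0∞) : Outcome S → ℝ≥0∞
  | .stuck => 0
  | .done V => φ V
  | .next c => g c
  | .branch c d => 2⁻¹ * g c + 2⁻¹ * g d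

/-- The expected reward of the results that the machine reaches in fewer than `n` steps. -/
noncomputable def run (φ : Term S → ℝ≥0∞) : ℕ → Conf S → ℝ≥0∞
  | 0, _ => 0
  | n + 1, c => (step c).expect φ (run φ n)

/-- The expected reward of the results of the machine. -/
noncomputable def runLim (φ : Term S → ℝ≥0∞) (c : Conf S) : ℝ≥0∞ :=
  ⨆ n, run φ n c

theorem Outcome.expect_mono (φ : Term S → ℝ≥0∞) {g h : Conf S → ℝ≥0∞} (hgh : g ≤ h)
    (o : Outcome S) : o.expect φ g ≤ o.expect φ h := by
  cases o with
  | stuck => exact le_rfl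
  | done V => exact le_rfl
  | next c => exact hgh c
  | branch c d => exact add_le_add (mul_le_mul_right (hgh c) _) (mul_le_mul_right (hgh d) _)

theorem run_le_succ (φ : Term S → ℝ≥0∞) (n : ℕ) : run φ n ≤ run φ (n + 1) := by
  induction n with
  | zero => exact fun c => zero_le
  | succ n ih => exact fun c => Outcome.expect_mono φ ih (step c)

theorem run_mono (φ : Term S → ℝ≥0∞) : Monotone (run φ) :=
  monotone_nat_of_le_succ (run_le_succ φ)

/-- Fixed-point equation for the limit. The supremum passes through the fair branch because both
runs increase with the number of steps. -/
theorem runLim_eq (φ : Term S → ℝ≥0∞) (c : Conf S) :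
    runLim φ c = (step c).expect φ (runLim φ) := by
  have h : runLim φ c = ⨆ n, run φ (n + 1) c := by
    refine le_antisymm (iSup_le fun n => ?_) (iSup_le fun n => le_iSup (fun n => run φ n c) (n + 1))
    exact le_iSup_of_le n (run_le_succ φ n c)
  rw [h]
  simp only [run]
  cases step c with
  | stuck => simp [Outcome.expect]
  | done V => simp [Outcome.expect]
  | next c => rfl
  | branch c d =>
    simp only [Outcome.expect, runLim, ENNReal.mul_iSup]
    exact (ENNReal.iSup_add_iSup_of_monotone
      (fun i j hij => mul_le_mul_right (run_mono φ hij c) _)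
      (fun i j hij => mul_le_mul_right (run_mono φ hij d) _)).symm

theorem runLim_next {φ : Term S → ℝ≥0∞} {c d : Conf S} (h : step c = .next d) :
    runLim φ c = runLim φ d := by
  rw [runLim_eq, h]; rfl

/-! ### Expectations -/

/-- The integral of `k` with respect to `D`. -/
noncomputable def integ (D k : Term S → ℝ≥0∞) : ℝ≥0∞ :=
  ∑' V, D V * k V

theorem integ_def (D k : Term S → ℝ≥0∞) : integ D k = ∑' V, D V * k V :=
  rfl

theorem integ_mono {D k k' : Term S → ℝ≥0∞} (h : ∀ V, D V ≠ 0 → k V ≤ k' V) :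
    integ D k ≤ integ D k' := by
  refine ENNReal.tsum_le_tsum fun V => ?_
  by_cases hV : D V = 0
  · simp [hV]
  · exact mul_le_mul_right (h V hV) _

theorem integ_dirac (V : Term S) (k : Term S → ℝ≥0∞) : integ (dirac V) k = k V := by
  rw [integ, tsum_eq_single V]
  · simp [dirac]
  · intro W hW
    simp [dirac, hW]

theorem integ_zero (k : Term S → ℝ≥0∞) : integ (fun _ => 0) k = 0 := by
  simp [integ]

theorem integ_add (D E k : Term S → ℝ≥0∞) :
    integ (fun U => D U + E U) k = integ D k + integ E k := by
  simp only [integ, add_mul, ENNReal.tsum_add]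

theorem integ_const_mul (a : ℝ≥0∞) (D k : Term S → ℝ≥0∞) :
    integ (fun U => a * D U) k = a * integ D k := by
  simp only [integ, mul_assoc, ENNReal.tsum_mul_left]

theorem integ_tsum {ι : Type*} (D : ι → Term S → ℝ≥0∞) (k : Term S → ℝ≥0∞) :
    integ (fun U => ∑' i, D i U) k = ∑' i, integ (D i) k := by
  simp only [integ, ← ENNReal.tsum_mul_right]
  exact ENNReal.tsum_comm

/-! ### Sums over all terms that are supported on the image of some constructors. -/

theorem tsum_eq_tsum_of_injective {ι : Type*} {c : ι → Term S} (hc : Function.Injective c)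
    {g : Term S → ℝ≥0∞} (h : ∀ V, (∀ i, V ≠ c i) → g V = 0) : ∑' V, g V = ∑' i, g (c i) := by
  refine (hc.tsum_eq fun V hV => ?_).symm
  by_contra hn
  exact hV (h V fun i hi => hn ⟨i, hi.symm⟩)

theorem tsum_eq_tsum_num {g : Term S → ℝ≥0∞} (h : ∀ V, (∀ n, V ≠ .num n) → g V = 0) :
    ∑' V, g V = ∑' n, g (.num n) :=
  tsum_eq_tsum_of_injective (fun a b hab => by injection hab) h

theorem tsum_eq_tsum_pair {g : Term S → ℝ≥0∞} (h : ∀ V, (∀ P N, V ≠ .pair P N) → g V = 0) :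
    ∑' V, g V = ∑' (P) (N), g (.pair P N) := by
  rw [← ENNReal.tsum_prod (f := fun P N => g (.pair P N))]
  exact tsum_eq_tsum_of_injective (c := fun p : Term S × Term S => Term.pair p.1 p.2)
    (fun a b hab => by injection hab with h1 h2; exact Prod.ext h1 h2)
    fun V hV => h V fun P N => hV (P, N)

theorem tsum_eq_add_tsum_cons {g : Term S → ℝ≥0∞}
    (h : ∀ V, V ≠ .nil → (∀ H T, V ≠ .cons H T) → g V = 0) :
    ∑' V, g V = g .nil + ∑' (H) (T), g (.cons H T) := by
  rw [tsum_eq_tsum_of_injective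
    (c := Sum.elim (fun _ : Unit => Term.nil) fun p : Term S × Term S => Term.cons p.1 p.2)
    _ fun V hV => h V (hV (.inl ())) fun H T => hV (.inr (H, T)),
    Summable.tsum_sum ENNReal.summable ENNReal.summable]
  · simp [ENNReal.tsum_prod']
  · rintro (a | ⟨a, a'⟩) (b | ⟨b, b'⟩) hab <;> simp_all

theorem tsum_eq_tsum_lam_add_fix {g : Term S → ℝ≥0∞}
    (h : ∀ V, (∀ P, V ≠ .lam P) → (∀ Q, V ≠ .fix Q) → g V = 0) :
    ∑' V, g V = (∑' P, g (.lam P)) + ∑' Q, g (.fix Q) := by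
  rw [tsum_eq_tsum_of_injective (c := Sum.elim Term.lam Term.fix)
    _ fun V hV => h V (fun P => hV (.inl P)) fun Q => hV (.inr Q),
    Summable.tsum_sum ENNReal.summable ENNReal.summable]
  · rfl
  · rintro (a | a) (b | b) hab <;> simp_all

theorem tsum_eq_bool {g : Term S → ℝ≥0∞} (h : ∀ V, (∀ b, V ≠ .bool b) → g V = 0) :
    ∑' V, g V = g (.bool true) + g (.bool false) := by
  rw [tsum_eq_tsum_of_injective (c := Term.bool) (fun a b hab => by injection hab) h, tsum_bool,
    add_comm]

/-! ### The value distributions of the big-step rules -/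

/-- The distribution in the rule for operators. -/
noncomputable def opDist (o : S.Op) (D E : Term S → ℝ≥0∞) : Term S → ℝ≥0∞ :=
  fun U => ∑' (n : ℕ) (m : ℕ), D (.num n) * E (.num m) * dirac (opConst o n m) U

/-- The distribution in the rule for applications. -/
noncomputable def appDist (K F : Term S → ℝ≥0∞) (E G : Term S → Term S → Term S → ℝ≥0∞) :
    Term S → ℝ≥0∞ :=
  fun U => ∑' V, F V * ((∑' P, K (.lam P) * E P V U) + ∑' Q, K (.fix Q) * G Q V U)

/-- The distribution in the rule for conditionals. -/
noncomputable def iteDist (D E₁ E₂ : Term S → ℝ≥0∞) : Term S → ℝ≥0∞ :=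
  fun U => D (.bool true) * E₁ U + D (.bool false) * E₂ U

/-- The distribution in the rule for the list destructor. -/
noncomputable def lcaseDist (D E : Term S → ℝ≥0∞) (G K F : Term S → Term S → Term S → ℝ≥0∞) :
    Term S → ℝ≥0∞ :=
  fun U => D .nil * E U + ∑' (H) (T) (V) (W), D (.cons H T) * G H T V * K H T W * F V W U

/-- The distribution in the rule for the first projection. -/
noncomputable def fstDist (D : Term S → ℝ≥0∞) (E : Term S → Term S → ℝ≥0∞) : Term S → ℝ≥0∞ :=
  fun U => ∑' (P) (N), D (.pair P N) * E P U

/-- The distribution in the rule for the second projection. -/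
noncomputable def sndDist (D : Term S → ℝ≥0∞) (E : Term S → Term S → ℝ≥0∞) : Term S → ℝ≥0∞ :=
  fun U => ∑' (P) (N), D (.pair P N) * E N U

/-- The distribution in the rule for choices. -/
noncomputable def choiceDist (D E : Term S → ℝ≥0∞) : Term S → ℝ≥0∞ :=
  fun U => 2⁻¹ * D U + 2⁻¹ * E U

/-- The reward of an operator at two values. -/
noncomputable def opReward (o : S.Op) (k : Term S → ℝ≥0∞) : Term S → Term S → ℝ≥0∞
  | .num n, .num m => k (opConst o n m)
  | _, _ => 0

/-- The reward of an application of values. -/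
noncomputable def appReward (E G : Term S → ℝ≥0∞) : Term S → ℝ≥0∞
  | .lam P => E P
  | .fix Q => G Q
  | _ => 0

/-- The reward of a conditional on a value. -/
noncomputable def iteReward (a b : ℝ≥0∞) : Term S → ℝ≥0∞
  | .bool true => a
  | .bool false => b
  | _ => 0

/-- The reward of the list destructor at a value. -/
noncomputable def lcaseReward (a : ℝ≥0∞) (E : Term S → Term S → ℝ≥0∞) : Term S → ℝ≥0∞
  | .nil => a
  | .cons H T => E H T
  | _ => 0

/-- The reward of a projection of a value. -/
noncomputable def pairReward (E : Term S → Term S → ℝ≥0∞) : Term S → ℝ≥0∞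
  | .pair P N => E P N
  | _ => 0

/-- This and the following `integ_*Dist` lemmas put the distribution of a big-step rule in
continuation-passing form: nested integrals in the order in which the machine evaluates the
subterms, with reward zero at values of the wrong shape. -/
theorem integ_opDist (o : S.Op) (D E k : Term S → ℝ≥0∞) :
    integ (opDist o D E) k = integ D fun V => integ E fun W => opReward o k V W := by
  unfold opDist
  simp only [integ_tsum, integ_const_mul, integ_dirac]
  rw [integ, tsum_eq_tsum_num]
  · refine tsum_congr fun n => ?_
    rw [integ, tsum_eq_tsum_num, ← ENNReal.tsum_mul_left]
    · simp only [opReward, mul_assoc]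
    · intro V hV
      cases V <;> simp_all [opReward]
  · intro V hV
    cases V <;> simp_all [opReward, integ]

theorem integ_appDist (K F : Term S → ℝ≥0∞) (E G : Term S → Term S → Term S → ℝ≥0∞)
    (k : Term S → ℝ≥0∞) :
    integ (appDist K F E G) k = integ K fun f => integ F fun V =>
      appReward (fun P => integ (E P V) k) (fun Q => integ (G Q V) k) f := by
  unfold appDist
  simp only [integ_tsum, integ_const_mul, integ_add]
  simp only [integ_def K, integ_def F, ← ENNReal.tsum_mul_left]
  -- The rule sums over the argument outermost, whereas the machine evaluates the function first.
  rw [ENNReal.tsum_comm]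
  refine tsum_congr fun V => ?_
  refine Eq.trans ?_ (tsum_eq_tsum_lam_add_fix ?_).symm
  · rw [mul_add, ← ENNReal.tsum_mul_left, ← ENNReal.tsum_mul_left]
    simp only [appReward, mul_left_comm]
  · intro f hP hQ
    cases f <;> simp_all [appReward]

theorem integ_iteDist (D E₁ E₂ k : Term S → ℝ≥0∞) :
    integ (iteDist D E₁ E₂) k = integ D (iteReward (integ E₁ k) (integ E₂ k)) := by
  unfold iteDist
  simp only [integ_const_mul, integ_add]
  refine Eq.trans ?_ (tsum_eq_bool ?_).symm
  · rfl
  · intro V hV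
    cases V <;> simp_all [iteReward]

theorem integ_lcaseDist (D E : Term S → ℝ≥0∞) (G K F : Term S → Term S → Term S → ℝ≥0∞)
    (k : Term S → ℝ≥0∞) :
    integ (lcaseDist D E G K F) k = integ D (lcaseReward (integ E k) fun H T =>
      integ (G H T) fun V => integ (K H T) fun W => integ (F V W) k) := by
  unfold lcaseDist
  simp only [integ_tsum, integ_const_mul, integ_add]
  refine Eq.trans ?_ (tsum_eq_add_tsum_cons ?_).symm
  · simp only [lcaseReward, integ_def (G _ _), integ_def (K _ _), ← ENNReal.tsum_mul_left, mul_assoc]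
  · intro V h1 h2
    cases V <;> simp_all [lcaseReward]

theorem integ_fstDist (D : Term S → ℝ≥0∞) (E : Term S → Term S → ℝ≥0∞) (k : Term S → ℝ≥0∞) :
    integ (fstDist D E) k = integ D (pairReward fun P _ => integ (E P) k) := by
  unfold fstDist
  simp only [integ_tsum, integ_const_mul]
  refine Eq.trans ?_ (tsum_eq_tsum_pair ?_).symm
  · rfl
  · intro V hV
    cases V <;> simp_all [pairReward]

theorem integ_sndDist (D : Term S → ℝ≥0∞) (E : Term S → Term S → ℝ≥0∞) (k : Term S → ℝ≥0∞) :
    integ (sndDist D E) k = integ D (pairReward fun _ N => integ (E N) k) := by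
  unfold sndDist
  simp only [integ_tsum, integ_const_mul]
  refine Eq.trans ?_ (tsum_eq_tsum_pair ?_).symm
  · rfl
  · intro V hV
    cases V <;> simp_all [pairReward]

theorem integ_choiceDist (D E k : Term S → ℝ≥0∞) :
    integ (choiceDist D E) k = 2⁻¹ * integ D k + 2⁻¹ * integ E k := by
  unfold choiceDist
  simp only [integ_const_mul, integ_add]

/-! ### The machine computes the big-step semantics -/

/-- Soundness of the machine. Quantifying over the stack lets the induction hypothesis of each
premise be used with the pending evaluation frame pushed. -/
theorem BigStep.integ_le {M : Term S} {D : Term S → ℝ≥0∞} (h : BigStep M D)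
    (φ : Term S → ℝ≥0∞) (K : List (Frame S)) :
    integ D (fun V => runLim φ (.ret K V)) ≤ runLim φ (.ev K M) := by
  induction h generalizing K with
  | empty M => simp [integ_zero]
  | value hV =>
    rw [integ_dirac]
    cases hV <;> exact (runLim_next rfl).ge
  | @op o M N D E _ _ ihM ihN =>
    change integ (opDist o D E) _ ≤ _
    rw [integ_opDist, runLim_next (d := .ev (.opL o N :: K) M) rfl]
    refine le_trans (integ_mono fun V _ => ?_) (ihM _)
    rw [runLim_next (d := .ev (.opR o V :: K) N) rfl]
    refine le_trans (integ_mono fun W _ => ?_) (ihN _)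
    unfold opReward
    split
    · exact (runLim_next rfl).ge
    · exact zero_le
  | @app M N D F E G _ _ _ _ ihM ihN ihE ihG =>
    change integ (appDist D F E G) _ ≤ _
    rw [integ_appDist, runLim_next (d := .ev (.appL N :: K) M) rfl]
    refine le_trans (integ_mono fun f hf => ?_) (ihM _)
    rw [runLim_next (d := .ev (.appR f :: K) N) rfl]
    refine le_trans (integ_mono fun V hV => ?_) (ihN _)
    unfold appReward
    split
    · exact (ihE _ _ hf hV _).trans (runLim_next rfl).ge
    · exact (ihG _ _ hf hV _).trans (runLim_next rfl).ge
    · exact zero_le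
  | @ite L M N D E₁ E₂ _ _ _ ihL ihM ihN =>
    change integ (iteDist D E₁ E₂) _ ≤ _
    rw [integ_iteDist, runLim_next (d := .ev (.ite M N :: K) L) rfl]
    refine le_trans (integ_mono fun V _ => ?_) (ihL _)
    unfold iteReward
    split
    · exact (ihM _).trans (runLim_next rfl).ge
    · exact (ihN _).trans (runLim_next rfl).ge
    · exact zero_le
  | @lcase L M N D E G K' F _ _ _ _ _ ihL ihM ihG ihK ihF =>
    change integ (lcaseDist D E G K' F) _ ≤ _
    rw [integ_lcaseDist, runLim_next (d := .ev (.lcase M N :: K) L) rfl]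
    refine le_trans (integ_mono fun V hV => ?_) (ihL _)
    unfold lcaseReward
    split
    · exact (ihM _).trans (runLim_next rfl).ge
    · rename_i H T
      rw [runLim_next (d := .ev (.head T N :: K) H) rfl]
      refine le_trans (integ_mono fun V hV' => ?_) (ihG _ _ hV _)
      rw [runLim_next (d := .ev (.tail V N :: K) T) rfl]
      refine le_trans (integ_mono fun W hW => ?_) (ihK _ _ hV _)
      exact (ihF _ _ _ _ hV hV' hW _).trans (runLim_next rfl).ge
    · exact zero_le
  | @fst M D E _ _ ihM ihE =>
    change integ (fstDist D E) _ ≤ _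
    rw [integ_fstDist, runLim_next (d := .ev (.fst :: K) M) rfl]
    refine le_trans (integ_mono fun V hV => ?_) (ihM _)
    unfold pairReward
    split
    · exact (ihE _ _ hV _).trans (runLim_next rfl).ge
    · exact zero_le
  | @snd M D E _ _ ihM ihE =>
    change integ (sndDist D E) _ ≤ _
    rw [integ_sndDist, runLim_next (d := .ev (.snd :: K) M) rfl]
    refine le_trans (integ_mono fun V hV => ?_) (ihM _)
    unfold pairReward
    split
    · exact (ihE _ _ hV _).trans (runLim_next rfl).ge
    · exact zero_le
  | @choice M N D E _ _ ihM ihN =>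
    change integ (choiceDist D E) _ ≤ _
    rw [integ_choiceDist, runLim_eq]
    exact add_le_add (mul_le_mul_right (ihM _) _) (mul_le_mul_right (ihN _) _)

/-- A canonical big-step approximation of depth `n`. -/
noncomputable def dist : ℕ → Term S → Term S → ℝ≥0∞
  | 0, _ => fun _ => 0
  | n + 1, M =>
    match M with
    | .var _ => fun _ => 0
    | .choice M N => choiceDist (dist n M) (dist n N)
    | .ite L M N => iteDist (dist n L) (dist n M) (dist n N)
    | .op o M N => opDist o (dist n M) (dist n N)
    | .fst M => fstDist (dist n M) (dist n)
    | .snd M => sndDist (dist n M) (dist n)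
    | .lcase L M N => lcaseDist (dist n L) (dist n M) (fun H _ => dist n H) (fun _ T => dist n T)
        (fun V W => dist n (N.inst₂ V W))
    | .app M N => appDist (dist n M) (dist n N) (fun P V => dist n (P.inst V))
        (fun Q V => dist n (.app (Q.inst (.fix Q)) V))
    | V => dirac V

theorem bigStep_dist (n : ℕ) (M : Term S) : BigStep M (dist n M) := by
  induction n generalizing M with
  | zero => exact .empty M
  | succ n ih =>
    cases M with
    | var i => exact .empty _
    | choice M N => exact .choice (ih M) (ih N)
    | ite L M N => exact .ite (ih L) (ih M) (ih N)
    | op o M N => exact .op (ih M) (ih N)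
    | fst M => exact .fst (ih M) fun P _ _ => ih P
    | snd M => exact .snd (ih M) fun _ N _ => ih N
    | lcase L M N =>
      exact .lcase (G := fun H _ => dist n H) (K := fun _ T => dist n T)
        (F := fun V W => dist n (N.inst₂ V W)) (ih L) (ih M) (fun H _ _ => ih H)
        (fun _ T _ => ih T) fun _ _ V W _ _ _ => ih _
    | app M N =>
      exact .app (E := fun P V => dist n (P.inst V))
        (G := fun Q V => dist n (.app (Q.inst (.fix Q)) V)) (ih M) (ih N)
        (fun P V _ _ => ih _) fun Q V _ _ => ih _
    | num m => exact .value (.num m)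
    | bool b => exact .value (.bool b)
    | nil => exact .value .nil
    | pair M N => exact .value (.pair M N)
    | cons M N => exact .value (.cons M N)
    | lam M => exact .value (.lam M)
    | fix M => exact .value (.fix M)

theorem run_next {φ : Term S → ℝ≥0∞} {c d : Conf S} (n : ℕ) (h : step c = .next d) :
    run φ (n + 1) c = run φ n d := by
  rw [run, h]; rfl

/-- Keeping the same fuel `n` on both sides lets a single depth serve all the subterms, as `dist`
requires. -/
theorem run_le_of_next {φ : Term S → ℝ≥0∞} {c d : Conf S} (n : ℕ) (h : step c = .next d) :
    run φ n c ≤ run φ n d :=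
  (run_le_succ φ n c).trans (run_next n h).le

theorem run_le_of_stuck {φ : Term S → ℝ≥0∞} {c : Conf S} (n : ℕ) (h : step c = .stuck) :
    run φ n c ≤ 0 := by
  cases n with
  | zero => exact le_rfl
  | succ n => rw [run, h]; rfl

/-- Completeness of the machine: whatever is earned in `n` steps is already accounted for by the
approximation of depth `n`, followed by a return to the stack. -/
theorem run_ev_le (φ : Term S → ℝ≥0∞) (n : ℕ) (K : List (Frame S)) (M : Term S) :
    run φ n (.ev K M) ≤ integ (dist n M) fun V => run φ n (.ret K V) := by
  induction n generalizing K M with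
  | zero => exact zero_le
  | succ n ih =>
    -- Evaluating the outermost constructor uses one unit of fuel, so only `n` units are needed for
    -- the return.
    refine le_trans ?_ (integ_mono fun V _ => run_le_succ φ n _)
    cases M with
    | var i => exact zero_le
    | choice M N =>
      refine le_trans ?_ (integ_choiceDist _ _ _).ge
      exact add_le_add (mul_le_mul_right (ih K M) _) (mul_le_mul_right (ih K N) _)
    | ite L M N =>
      refine le_trans ?_ (integ_iteDist _ _ _ _).ge
      rw [run_next n rfl]
      refine (ih _ L).trans (integ_mono fun V _ => ?_)
      unfold iteReward
      split
      · exact (run_le_of_next n rfl).trans (ih K M)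
      · exact (run_le_of_next n rfl).trans (ih K N)
      · exact run_le_of_stuck n (by cases V <;> simp_all [step, retStep, iteStep])
    | op o M N =>
      refine le_trans ?_ (integ_opDist _ _ _ _).ge
      rw [run_next n rfl]
      refine (ih _ M).trans (integ_mono fun V _ => ?_)
      refine ((run_le_of_next n rfl).trans (ih _ N)).trans (integ_mono fun W _ => ?_)
      unfold opReward
      split
      · exact run_le_of_next n rfl
      · refine run_le_of_stuck n ?_
        simp only [step, retStep]
        unfold opStep
        split
        · simp_all
        · rfl
    | fst M =>
      refine le_trans ?_ (integ_fstDist _ _ _).ge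
      rw [run_next n rfl]
      refine (ih _ M).trans (integ_mono fun V _ => ?_)
      unfold pairReward
      split
      · exact (run_le_of_next n rfl).trans (ih K _)
      · exact run_le_of_stuck n (by cases V <;> simp_all [step, retStep, fstStep])
    | snd M =>
      refine le_trans ?_ (integ_sndDist _ _ _).ge
      rw [run_next n rfl]
      refine (ih _ M).trans (integ_mono fun V _ => ?_)
      unfold pairReward
      split
      · exact (run_le_of_next n rfl).trans (ih K _)
      · exact run_le_of_stuck n (by cases V <;> simp_all [step, retStep, sndStep])
    | lcase L M N =>
      refine le_trans ?_ (integ_lcaseDist _ _ _ _ _ _).ge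
      rw [run_next n rfl]
      refine (ih _ L).trans (integ_mono fun V _ => ?_)
      unfold lcaseReward
      split
      · exact (run_le_of_next n rfl).trans (ih K _)
      · refine ((run_le_of_next n rfl).trans (ih _ _)).trans (integ_mono fun V _ => ?_)
        refine ((run_le_of_next n rfl).trans (ih _ _)).trans (integ_mono fun W _ => ?_)
        exact (run_le_of_next n rfl).trans (ih K _)
      · exact run_le_of_stuck n (by cases V <;> simp_all [step, retStep, lcaseStep])
    | app M N =>
      refine le_trans ?_ (integ_appDist _ _ _ _ _).ge
      rw [run_next n rfl]
      refine (ih _ M).trans (integ_mono fun f _ => ?_)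
      refine ((run_le_of_next n rfl).trans (ih _ N)).trans (integ_mono fun V _ => ?_)
      unfold appReward
      split
      · exact (run_le_of_next n rfl).trans (ih K _)
      · exact (run_le_of_next n rfl).trans (ih K _)
      · exact run_le_of_stuck n (by cases f <;> simp_all [step, retStep, applyStep])
    | num m => exact (integ_dirac _ _).ge
    | bool b => exact (integ_dirac _ _).ge
    | nil => exact (integ_dirac _ _).ge
    | pair M N => exact (integ_dirac _ _).ge
    | cons M N => exact (integ_dirac _ _).ge
    | lam M => exact (integ_dirac _ _).ge
    | fix M => exact (integ_dirac _ _).ge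

theorem BigStep.le_sem {M : Term S} {D : Term S → ℝ≥0∞} (h : BigStep M D) : D ≤ sem M :=
  le_iSup₂_of_le D h le_rfl

theorem runLim_ret_nil (φ : Term S → ℝ≥0∞) (V : Term S) : runLim φ (.ret [] V) = φ V := by
  rw [runLim_eq]; rfl

theorem runLim_le_conv (M : Term S) : runLim (fun _ => 1) (.ev [] M) ≤ conv M := by
  refine iSup_le fun n => (run_ev_le _ n [] M).trans (ENNReal.tsum_le_tsum fun V => ?_)
  refine le_trans (mul_le_of_le_one_right zero_le ?_) ((bigStep_dist n M).le_sem V)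
  exact (le_iSup (fun n => run (fun _ => 1) n (Conf.ret [] V)) n).trans (runLim_ret_nil _ V).le

theorem sem_le_runLim (M V : Term S) : sem M V ≤ runLim (fun W => dirac W V) (.ev [] M) := by
  simp only [sem, iSup_apply]
  refine iSup₂_le fun D hD => le_trans ?_ (hD.integ_le _ [])
  simp only [runLim_ret_nil]
  refine le_trans (le_of_eq ?_) (ENNReal.le_tsum V)
  simp [dirac]

/-- A run ends in a single value, which earns at most one of the indicator rewards. This bounds the
sum over values of the separate suprema in `conv`. -/
theorem sum_run_le (s : Finset (Term S)) (n : ℕ) (c : Conf S) :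
    ∑ V ∈ s, run (fun W => dirac W V) n c ≤ run (fun _ => 1) n c := by
  classical
  induction n generalizing c with
  | zero => simp [run]
  | succ n ih =>
    simp only [run]
    cases step c with
    | stuck => simp [Outcome.expect]
    | done V =>
      simp only [Outcome.expect, dirac, Finset.sum_ite_eq']
      split <;> simp
    | next c => exact ih c
    | branch c d =>
      simp only [Outcome.expect, Finset.sum_add_distrib, ← Finset.mul_sum]
      exact add_le_add (mul_le_mul_right (ih c) _) (mul_le_mul_right (ih d) _)

theorem conv_le_runLim (M : Term S) : conv M ≤ runLim (fun _ => 1) (.ev [] M) := by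
  refine (ENNReal.tsum_le_tsum fun V => sem_le_runLim M V).trans ?_
  rw [ENNReal.tsum_eq_iSup_sum]
  refine iSup_le fun s => ?_
  simp only [runLim]
  rw [ENNReal.finsetSum_iSup_of_monotone (f := fun V n => run (fun W => dirac W V) n (.ev [] M))
    fun V i j hij => run_mono _ hij _]
  exact iSup_mono fun n => sum_run_le s n _

theorem conv_eq_runLim (M : Term S) : conv M = runLim (fun _ => 1) (.ev [] M) :=
  le_antisymm (conv_le_runLim M) (runLim_le_conv M)

/-! ### Machine steps and substitution -/

/-- The configurations whose next step is determined by the value of a free variable. -/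
inductive Conf.HeadVar : Conf S → Prop
  | ev (K i) : HeadVar (.ev K (.var i))
  | ret (K i W) : HeadVar (.ret (.appR (.var i) :: K) W)

theorem opConst_subst (o : S.Op) (n m : ℕ) (s : ℕ → Term S) :
    (opConst o n m).subst s = opConst o n m := by
  unfold opConst
  split <;> rfl

/-- A variable is stuck under an operator, conditional, projection or case frame, and so is a
lambda. Substituting lambdas can therefore change a step only when a variable is evaluated or
applied. -/
theorem step_subst {s : ℕ → Term S} (hs : ∀ i, ∃ P, s i = .lam P) {c : Conf S}
    (hc : ¬ c.HeadVar) : step (c.subst s) = (step c).subst s := by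
  cases c with
  | ev K M =>
    cases M with
    | var i => exact absurd (.ev K i) hc
    | _ => rfl
  | ret K V =>
    cases K with
    | nil => rfl
    | cons F K =>
      cases F with
      | appL N => rfl
      | appR f =>
        cases f with
        | var i => exact absurd (.ret K i V) hc
        | lam P =>
          simp [Conf.subst, step, retStep, applyStep, Outcome.subst, Frame.subst, Term.subst,
            Term.subst_inst]
        | fix Q =>
          simp [Conf.subst, step, retStep, applyStep, Outcome.subst, Frame.subst, Term.subst,
            Term.subst_inst]
        | _ => rfl
      | opL o N => rfl
      | opR o W =>
        cases W with
        | var i =>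
          obtain ⟨P, hP⟩ := hs i
          simp [Conf.subst, step, retStep, opStep, Outcome.subst, Frame.subst, Term.subst, hP]
        | num n =>
          cases V with
          | var i =>
            obtain ⟨P, hP⟩ := hs i
            simp [Conf.subst, step, retStep, opStep, Outcome.subst, Frame.subst, Term.subst, hP]
          | num m =>
            simp [Conf.subst, step, retStep, opStep, Outcome.subst, Frame.subst, Term.subst,
              opConst_subst]
          | _ => rfl
        | _ => rfl
      | ite M N =>
        cases V with
        | var i =>
          obtain ⟨P, hP⟩ := hs i
          simp [Conf.subst, step, retStep, iteStep, Outcome.subst, Frame.subst, Term.subst, hP]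
        | bool b => cases b <;> rfl
        | _ => rfl
      | fst =>
        cases V with
        | var i =>
          obtain ⟨P, hP⟩ := hs i
          simp [Conf.subst, step, retStep, fstStep, Outcome.subst, Frame.subst, Term.subst, hP]
        | _ => rfl
      | snd =>
        cases V with
        | var i =>
          obtain ⟨P, hP⟩ := hs i
          simp [Conf.subst, step, retStep, sndStep, Outcome.subst, Frame.subst, Term.subst, hP]
        | _ => rfl
      | lcase M N =>
        cases V with
        | var i =>
          obtain ⟨P, hP⟩ := hs i
          simp [Conf.subst, step, retStep, lcaseStep, Outcome.subst, Frame.subst, Term.subst, hP]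
        | _ => rfl
      | head T N => rfl
      | tail W N =>
        simp [Conf.subst, step, retStep, Outcome.subst, Frame.subst, Term.subst_inst₂]

/-- Makes room for a new hole variable `0`: the stack is shifted, and the extended substitution acts
on it as the old one did. -/
theorem map_frame_shift (K : List (Frame S)) (V : Term S) (s : ℕ → Term S) :
    (K.map (Frame.subst fun n => .var (n + 1))).map (Frame.subst (scons V s)) =
      K.map (Frame.subst s) := by
  rw [List.map_map]
  exact List.map_congr_left fun F _ => Frame.subst_subst F _ _

/-! ### Averages over coin flips -/

/-- The average of `F` over the outcomes of coin flips, where an entry `true` stands for a coin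
that is known to show `true`, and an entry `false` for a coin yet to be flipped. -/
noncomputable def avg : List Bool → (List Bool → ℝ≥0∞) → ℝ≥0∞
  | [], F => F []
  | true :: st, F => avg st fun b => F (true :: b)
  | false :: st, F => 2⁻¹ * avg st (fun b => F (true :: b)) + 2⁻¹ * avg st fun b => F (false :: b)

theorem avg_mono {st : List Bool} {F G : List Bool → ℝ≥0∞}
    (h : ∀ b, b.length = st.length → F b ≤ G b) : avg st F ≤ avg st G := by
  induction st generalizing F G with
  | nil => exact h [] rfl
  | cons x st ih =>
    have ih' (y : Bool) : avg st (fun b => F (y :: b)) ≤ avg st fun b => G (y :: b) :=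
      ih fun b hb => h (y :: b) (by simp [hb])
    cases x with
    | true => exact ih' true
    | false => exact add_le_add (mul_le_mul_right (ih' true) _) (mul_le_mul_right (ih' false) _)

theorem half_add_half (a : ℝ≥0∞) : 2⁻¹ * a + 2⁻¹ * a = a := by
  rw [← add_mul, ENNReal.inv_two_add_inv_two, one_mul]

theorem avg_const (st : List Bool) (a : ℝ≥0∞) : avg st (fun _ => a) = a := by
  induction st with
  | nil => rfl
  | cons x st ih => cases x <;> simp [avg, ih, half_add_half]

theorem avg_choice (st : List Bool) (F G : List Bool → ℝ≥0∞) :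
    avg st (fun b => 2⁻¹ * F b + 2⁻¹ * G b) = 2⁻¹ * avg st F + 2⁻¹ * avg st G := by
  induction st generalizing F G with
  | nil => rfl
  | cons x st ih =>
    cases x with
    | true => exact ih _ _
    | false => simp only [avg, ih]; ring

/-- If coin `i` is not yet flipped, the outcomes where it shows `true` have weight one half and the
others are dropped. If it is already known, the factor one half is simply lost. Hence `F` and `G`
need comparing only where coin `i` is `true`. -/
theorem half_mul_avg_set_le {st : List Bool} {i : ℕ} (hi : i < st.length)
    {F G : List Bool → ℝ≥0∞}
    (h : ∀ b, b.length = st.length → b[i]? = some true → F b ≤ G b) :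
    2⁻¹ * avg (st.set i true) F ≤ avg st G := by
  induction st generalizing i F G with
  | nil => simp at hi
  | cons x st ih =>
    cases i with
    | zero =>
      have h' : avg st (fun b => F (true :: b)) ≤ avg st fun b => G (true :: b) :=
        avg_mono fun b hb => h _ (by simp [hb]) rfl
      cases x with
      | true => exact (mul_le_of_le_one_left zero_le (by simp)).trans h'
      | false => exact (mul_le_mul_right h' _).trans le_self_add
    | succ i =>
      have ih' (y : Bool) : 2⁻¹ * avg (st.set i true) (fun b => F (y :: b)) ≤
          avg st fun b => G (y :: b) :=
        ih (by simpa using hi) fun b hb hbi => h (y :: b) (by simp [hb]) (by simpa using hbi)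
      cases x with
      | true => exact ih' true
      | false =>
        simp only [List.set_cons_succ, avg, mul_add]
        exact add_le_add (mul_le_mul_right (ih' true) _) (mul_le_mul_right (ih' false) _)

/-! ### The two fillings of the holes -/

/-- The function `λy. (Ω ⊕ I)`. -/
def flipper : Term S := .lam (.choice Omega I)

/-- The function `λy. I` or `λy. Ω`. -/
def coin : Bool → Term S
  | true => .lam I
  | false => .lam Omega

/-- The substitution of `λy. (Ω ⊕ I)` for the first `k` variables and of `termM` for the others. -/
def leftHoles : ℕ → ℕ → Term S
  | 0 => fun _ => termM
  | k + 1 => scons flipper (leftHoles k)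

/-- The substitution of `λy. I` or `λy. Ω` for the first variables and of `termN` for the others. -/
def rightHoles : List Bool → ℕ → Term S
  | [] => fun _ => termN
  | x :: b => scons (coin x) (rightHoles b)

theorem leftHoles_of_lt {k i : ℕ} (h : i < k) : (leftHoles k i : Term S) = flipper := by
  induction k generalizing i with
  | zero => simp at h
  | succ k ih =>
    cases i with
    | zero => rfl
    | succ i => exact ih (by simpa using h)

theorem leftHoles_of_le {k i : ℕ} (h : k ≤ i) : (leftHoles k i : Term S) = termM := by
  induction k generalizing i with
  | zero => rfl
  | succ k ih =>
    cases i with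
    | zero => simp at h
    | succ i => exact ih (by simpa using h)

theorem rightHoles_of_getElem? {b : List Bool} {i : ℕ} {x : Bool} (h : b[i]? = some x) :
    (rightHoles b i : Term S) = coin x := by
  induction b generalizing i with
  | nil => simp at h
  | cons y b ih =>
    cases i with
    | zero =>
      obtain rfl : y = x := by simpa using h
      rfl
    | succ i => exact ih (by simpa using h)

theorem rightHoles_of_le {b : List Bool} {i : ℕ} (h : b.length ≤ i) :
    (rightHoles b i : Term S) = termN := by
  induction b generalizing i with
  | nil => rfl
  | cons y b ih =>
    cases i with
    | zero => simp at h
    | succ i => exact ih (by simpa using h)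

theorem leftHoles_eq_lam (k i : ℕ) : ∃ P, (leftHoles k i : Term S) = .lam P := by
  rcases lt_or_ge i k with h | h
  · exact ⟨_, leftHoles_of_lt h⟩
  · exact ⟨_, leftHoles_of_le h⟩

theorem rightHoles_eq_lam (b : List Bool) (i : ℕ) : ∃ P, (rightHoles b i : Term S) = .lam P := by
  rcases lt_or_ge i b.length with h | h
  · rw [rightHoles_of_getElem? (List.getElem?_eq_getElem h)]
    cases b[i] <;> exact ⟨_, rfl⟩
  · exact ⟨_, rightHoles_of_le h⟩

/-! ### Divergence of `Omega`, and the lockstep comparison. -/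

theorem run_Omega (φ : Term S → ℝ≥0∞) (n : ℕ) (K : List (Frame S)) :
    run φ n (.ev K Omega) = 0 := by
  induction n with
  | zero => rfl
  | succ n ih =>
    refine le_antisymm ?_ zero_le
    calc run φ (n + 1) (.ev K Omega) = run φ n (.ev (.appL (.num 0) :: K) (.fix (.var 0))) := rfl
      _ ≤ run φ n (.ret (.appL (.num 0) :: K) (.fix (.var 0))) := run_le_of_next n rfl
      _ ≤ run φ n (.ev (.appR (.fix (.var 0)) :: K) (.num 0)) := run_le_of_next n rfl
      _ ≤ run φ n (.ret (.appR (.fix (.var 0)) :: K) (.num 0)) := run_le_of_next n rfl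
      _ ≤ run φ n (.ev K Omega) := run_le_of_next n rfl
      _ ≤ 0 := ih.le

theorem runLim_Omega (φ : Term S → ℝ≥0∞) (K : List (Frame S)) : runLim φ (.ev K Omega) = 0 := by
  simp [runLim, run_Omega]

theorem run_choice_Omega_le (φ : Term S → ℝ≥0∞) (n : ℕ) (K : List (Frame S)) (M : Term S) :
    run φ n (.ev K (.choice Omega M)) ≤ 2⁻¹ * run φ n (.ev K M) := by
  refine (run_le_succ φ n _).trans (le_of_eq ?_)
  change 2⁻¹ * run φ n (.ev K Omega) + 2⁻¹ * run φ n (.ev K M) = _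
  rw [run_Omega, mul_zero, zero_add]

/-- Induction on the steps of the left run, for all coin states and configurations at once: the
number of coins grows when `termM` is applied, and a coin becomes known when `flipper` is applied.
-/
theorem run_leftHoles_le (n : ℕ) (st : List Bool) (c : Conf S) :
    run (fun _ => 1) n (c.subst (leftHoles st.length)) ≤
      avg st fun b => runLim (fun _ => 1) (c.subst (rightHoles b)) := by
  induction n generalizing st c with
  | zero => exact zero_le
  | succ n ih =>
    by_cases hc : c.HeadVar
    · cases hc with
      | ev K i =>
        obtain ⟨P, hP⟩ := leftHoles_eq_lam (S := S) st.length i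
        -- The returned lambda is kept symbolic as the variable `i`, so that both sides remain
        -- instances of one configuration.
        rw [run_next (d := (Conf.ret K (.var i)).subst (leftHoles st.length)) n
          (by simp only [Conf.subst, Term.subst, hP]; rfl)]
        refine (ih _ _).trans (avg_mono fun b _ => ?_)
        obtain ⟨Q, hQ⟩ := rightHoles_eq_lam (S := S) b i
        exact (runLim_next (by simp only [Conf.subst, Term.subst, hQ]; rfl)).ge
      | ret K i W =>
        rcases lt_or_ge i st.length with hi | hi
        · rw [run_next (d := .ev (K.map (Frame.subst (leftHoles st.length))) (.choice Omega I)) n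
            (by simp only [Conf.subst, Term.subst, List.map_cons, Frame.subst,
                  leftHoles_of_lt hi]; rfl)]
          refine (run_choice_Omega_le _ _ _ _).trans ?_
          -- Applying `flipper`: the `Omega` half earns nothing, and the other half continues with
          -- coin `i` known to be `true`.
          have h := ih (st.set i true) (Conf.ev K I)
          rw [List.length_set] at h
          refine (mul_le_mul_right h _).trans (half_mul_avg_set_le hi fun b _ hb => ?_)
          exact (runLim_next (by simp only [Conf.subst, Term.subst, List.map_cons, Frame.subst,
                  rightHoles_of_getElem? hb]; rfl)).ge
        -- Applying the original hole variable: its result becomes a new hole variable `0`, with an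
        -- unflipped coin on the right.
        · have h := ih (false :: st)
            (.ev (K.map (Frame.subst fun n => .var (n + 1))) (.var 0))
          simp only [Conf.subst, List.length_cons, leftHoles, rightHoles, avg,
            map_frame_shift] at h
          rw [run_next (d := .ev (K.map (Frame.subst (leftHoles st.length))) flipper) n
            (by simp only [Conf.subst, Term.subst, List.map_cons, Frame.subst,
                  leftHoles_of_le hi]; rfl)]
          refine h.trans ?_
          rw [← avg_choice]
          refine avg_mono fun b hb => ?_
          refine le_trans ?_ (runLim_next (d := .ev (K.map (Frame.subst (rightHoles b)))
              (.choice (.lam Omega) (.lam I)))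
            (by simp only [Conf.subst, Term.subst, List.map_cons, Frame.subst,
                  rightHoles_of_le (hb.trans_le hi)]; rfl)).ge
          -- `avg` lists the outcome `true` first, while `termN` has the divergent branch first.
          rw [add_comm]
          exact (runLim_eq _ _).ge
    · rw [run, step_subst (leftHoles_eq_lam _) hc]
      have hr (b : List Bool) := step_subst (rightHoles_eq_lam (S := S) b) hc
      -- Here both sides take the same step of `c`; the right-hand limit is unfolded once for every
      -- outcome of the coins.
      simp only [fun b => runLim_eq (fun _ => 1) (c.subst (rightHoles b)), hr]
      cases step c with
      | stuck => exact zero_le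
      | done V => exact (avg_const st 1).ge
      | next d => exact ih st d
      | branch d e =>
        refine le_trans ?_ (avg_choice st _ _).ge
        exact add_le_add (mul_le_mul_right (ih st d) _) (mul_le_mul_right (ih st e) _)

theorem conv_subst_le (T : Term S) :
    conv (T.subst fun _ => termM) ≤ conv (T.subst fun _ => termN) := by
  rw [conv_eq_runLim, conv_eq_runLim]
  exact iSup_le fun n => run_leftHoles_le n [] (.ev [] T)

/-! ### Contexts -/

theorem upSub_eq_var {Γ : List Ty} {s : ℕ → Term S} (hs : ∀ i < Γ.length, s i = .var i) (τ : Ty) :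
    ∀ i < (τ :: Γ).length, upSub s i = .var i := by
  rintro (_ | i) hi
  · rfl
  · change (s i).rename Nat.succ = _
    rw [hs i (by simpa using hi)]
    rfl

theorem Typed.subst_eq {Γ : List Ty} {M : Term S} {σ : Ty} (h : Typed Γ M σ) {s : ℕ → Term S}
    (hs : ∀ i < Γ.length, s i = .var i) : M.subst s = M := by
  induction h generalizing s with
  | var h => exact hs _ (List.getElem?_eq_some_iff.1 h).1
  | lam _ ih => simp only [Term.subst, ih (upSub_eq_var hs _)]
  | fix _ ih => simp only [Term.subst, ih (upSub_eq_var hs _)]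
  | lcase _ _ _ ih₁ ih₂ ih₃ =>
    simp only [Term.subst, ih₁ hs, ih₂ hs, ih₃ (upSub_eq_var (upSub_eq_var hs _) _)]
  | num | bool | nil => rfl
  | pair _ _ ih₁ ih₂ | cons _ _ ih₁ ih₂ | choice _ _ ih₁ ih₂ | op _ _ ih₁ ih₂
  | app _ _ ih₁ ih₂ => simp only [Term.subst, ih₁ hs, ih₂ hs]
  | ite _ _ _ ih₁ ih₂ ih₃ => simp only [Term.subst, ih₁ hs, ih₂ hs, ih₃ hs]
  | fst _ ih | snd _ ih => simp only [Term.subst, ih hs]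

theorem upSub_eq_of_le {Γ : List Ty} {s : ℕ → Term S} {P : Term S} (hP : P.rename Nat.succ = P)
    (hs : ∀ i, Γ.length ≤ i → s i = P) (τ : Ty) :
    ∀ i, (τ :: Γ).length ≤ i → upSub s i = P := by
  rintro (_ | i) hi
  · simp at hi
  · change (s i).rename Nat.succ = _
    rw [hs i (by simpa using hi), hP]

/-- At the hole, `Δ.length` is the first index not in scope, hence a variable that no binder of `C`
captures and that does not occur in the rest of `C`. When `Γ` is empty it is the variable `0` seen
from outside. -/
theorem CtxTyped.subst_plug_var {Δ Γ : List Ty} {B τ : Ty} {C : Ctx S}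
    (h : CtxTyped Δ B Γ C τ) {P : Term S} (hP : P.rename Nat.succ = P) {s : ℕ → Term S}
    (hs : ∀ i < Γ.length, s i = .var i) (hsP : ∀ i, Γ.length ≤ i → s i = P) :
    (C.plug (.var Δ.length)).subst s = C.plug P := by
  induction h generalizing s with
  | hole => exact hsP _ le_rfl
  | lam _ ih => simp only [Ctx.plug, Term.subst, ih (upSub_eq_var hs _) (upSub_eq_of_le hP hsP _)]
  | fix _ ih => simp only [Ctx.plug, Term.subst, ih (upSub_eq_var hs _) (upSub_eq_of_le hP hsP _)]
  | appL _ h ih => simp only [Ctx.plug, Term.subst, ih hs hsP, h.subst_eq hs]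
  | appR h _ ih => simp only [Ctx.plug, Term.subst, ih hs hsP, h.subst_eq hs]
  | choiceL _ h ih => simp only [Ctx.plug, Term.subst, ih hs hsP, h.subst_eq hs]
  | choiceR h _ ih => simp only [Ctx.plug, Term.subst, ih hs hsP, h.subst_eq hs]
  | opL _ h ih => simp only [Ctx.plug, Term.subst, ih hs hsP, h.subst_eq hs]
  | opR h _ ih => simp only [Ctx.plug, Term.subst, ih hs hsP, h.subst_eq hs]
  | pairL _ h ih => simp only [Ctx.plug, Term.subst, ih hs hsP, h.subst_eq hs]
  | pairR h _ ih => simp only [Ctx.plug, Term.subst, ih hs hsP, h.subst_eq hs]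
  | fst _ ih => simp only [Ctx.plug, Term.subst, ih hs hsP]
  | snd _ ih => simp only [Ctx.plug, Term.subst, ih hs hsP]
  | consL _ h ih => simp only [Ctx.plug, Term.subst, ih hs hsP, h.subst_eq hs]
  | consR h _ ih => simp only [Ctx.plug, Term.subst, ih hs hsP, h.subst_eq hs]
  | ite₁ _ h h' ih => simp only [Ctx.plug, Term.subst, ih hs hsP, h.subst_eq hs, h'.subst_eq hs]
  | ite₂ h _ h' ih => simp only [Ctx.plug, Term.subst, ih hs hsP, h.subst_eq hs, h'.subst_eq hs]
  | ite₃ h h' _ ih => simp only [Ctx.plug, Term.subst, ih hs hsP, h.subst_eq hs, h'.subst_eq hs]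
  | lcase₁ _ h h' ih =>
    simp only [Ctx.plug, Term.subst, ih hs hsP, h.subst_eq hs, h'.subst_eq (upSub_eq_var (upSub_eq_var hs _) _)]
  | lcase₂ h _ h' ih =>
    simp only [Ctx.plug, Term.subst, ih hs hsP, h.subst_eq hs, h'.subst_eq (upSub_eq_var (upSub_eq_var hs _) _)]
  | lcase₃ h h' _ ih =>
    simp only [Ctx.plug, Term.subst, ih (upSub_eq_var (upSub_eq_var hs _) _) (upSub_eq_of_le hP (upSub_eq_of_le hP hsP _) _), h.subst_eq hs,
      h'.subst_eq hs]

theorem typed_I {Γ : List Ty} {σ : Ty} : Typed Γ (I : Term S) (.arrow σ σ) :=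
  .lam (.var rfl)

theorem typed_Omega {Γ : List Ty} {σ : Ty} : Typed Γ (Omega : Term S) σ :=
  .app (.fix (.var rfl)) .num

theorem typed_termM : Typed [] (termM : Term S) tyMN :=
  .lam (.lam (.choice typed_Omega typed_I))

theorem typed_termN : Typed [] (termN : Term S) tyMN :=
  .lam (.choice (.lam typed_Omega) (.lam typed_I))

theorem ctxPreorder_termM_termN : CtxPreorder [] tyMN (termM : Term S) termN := by
  refine ⟨typed_termM, typed_termN, fun Δ ρ _ _ C σ hC => ?_⟩
  -- Renaming leaves the two closed terms unchanged definitionally.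
  change conv (C.plug termM) ≤ conv (C.plug termN)
  rw [← hC.subst_plug_var (P := termM) (s := fun _ => termM) rfl (by simp) (by simp),
    ← hC.subst_plug_var (P := termN) (s := fun _ => termN) rfl (by simp) (by simp)]
  exact conv_subst_le _

/-! ### The two terms are not related by similarity -/

theorem dirac_ne_zero {V W : Term S} (h : dirac V W ≠ 0) : W = V := by
  by_contra hn
  exact h (by simp [dirac, hn])

theorem dirac_le_sem {V : Term S} (hV : IsValue V) : dirac V ≤ sem V :=
  (BigStep.value hV).le_sem

theorem runLim_lam (φ : Term S → ℝ≥0∞) (P : Term S) : runLim φ (.ev [] (.lam P)) = φ (.lam P) :=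
  (runLim_next rfl).trans (runLim_ret_nil φ _)

theorem runLim_choice (φ : Term S → ℝ≥0∞) (K : List (Frame S)) (M N : Term S) :
    runLim φ (.ev K (.choice M N)) = 2⁻¹ * runLim φ (.ev K M) + 2⁻¹ * runLim φ (.ev K N) :=
  runLim_eq _ _

theorem sem_lam_le (P V : Term S) : sem (.lam P) V ≤ dirac (.lam P) V :=
  (sem_le_runLim _ V).trans (runLim_lam _ P).le

theorem sem_choice_lam_le (P Q V : Term S) :
    sem (.choice (.lam P) (.lam Q)) V ≤ 2⁻¹ * dirac (.lam P) V + 2⁻¹ * dirac (.lam Q) V := by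
  refine (sem_le_runLim _ V).trans ?_
  rw [runLim_choice, runLim_lam, runLim_lam]

theorem le_sem_choice_lam (P Q V : Term S) :
    2⁻¹ * dirac (.lam P) V + 2⁻¹ * dirac (.lam Q) V ≤ sem (.choice (.lam P) (.lam Q)) V :=
  (BigStep.choice (.value (.lam P)) (.value (.lam Q))).le_sem V

theorem sem_Omega (V : Term S) : sem Omega V = 0 :=
  le_antisymm ((sem_le_runLim _ V).trans (runLim_Omega _ _).le) zero_le

theorem sem_choice_Omega_lam_le (P V : Term S) :
    sem (.choice Omega (.lam P)) V ≤ 2⁻¹ * dirac (.lam P) V := by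
  refine (sem_le_runLim _ V).trans ?_
  rw [runLim_choice, runLim_lam, runLim_Omega, mul_zero, zero_add]

theorem le_sem_choice_Omega_lam (P V : Term S) :
    2⁻¹ * dirac (.lam P) V ≤ sem (.choice Omega (.lam P)) V :=
  le_add_self.trans ((BigStep.choice (.empty Omega) (.value (.lam P))).le_sem V)

theorem IsProbSimulation.le_tsum {Q L : Type} {P : Q → L → Q → ℝ≥0∞} {R : Q → Q → Prop}
    (h : IsProbSimulation P R) {s t : Q} (hst : R s t) (l : L) (x : Q) :
    P s l x ≤ ∑' y : {y | R x y}, P t l y := by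
  have hR : {y | ∃ x' ∈ ({x} : Set Q), R x' y} = {y | R x y} := by simp
  have := h.sim s t hst l {x}
  rwa [tsum_singleton x (P s l), hR] at this

/-- Testing the singleton `{x}`: if `y` is the only state above `x` that `t` can reach, all the
required mass sits at `y`. -/
theorem IsProbSimulation.le_of_unique {Q L : Type} {P : Q → L → Q → ℝ≥0∞} {R : Q → Q → Prop}
    (h : IsProbSimulation P R) {s t : Q} (hst : R s t) (l : L) (x y : Q)
    (hy : ∀ z, R x z → P t l z ≠ 0 → z = y) : P s l x ≤ P t l y := by
  refine (h.le_tsum hst l x).trans ?_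
  rw [tsum_subtype {z | R x z} (P t l), tsum_eq_single y]
  · exact Set.indicator_le_self' (fun _ _ => zero_le) y
  · intro z hz
    rw [Set.indicator_apply_eq_zero]
    intro hxz
    by_contra h0
    exact hz (hy z hxz h0)

theorem IsProbSimulation.exists_of_ne_zero {Q L : Type} {P : Q → L → Q → ℝ≥0∞}
    {R : Q → Q → Prop} (h : IsProbSimulation P R) {s t : Q} (hst : R s t) (l : L) (x : Q)
    (hx : P s l x ≠ 0) : ∃ y, R x y ∧ P t l y ≠ 0 := by
  by_contra! hn
  refine hx (le_antisymm ((h.le_tsum hst l x).trans (le_of_eq ?_)) zero_le)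
  exact ENNReal.tsum_eq_zero.2 fun y => hn y y.2

theorem trans_eval_val {M V : Term S} {σ : Ty} (h : Typed [] M σ) (hV : IsValue V)
    (h' : Typed [] V σ) : trans (.tm M σ h) .eval (.val V σ hV h') = sem M V := by
  simp [trans]

theorem exists_of_trans_eval_ne_zero {M : Term S} {σ : Ty} {h : Typed [] M σ} {y : State S}
    (hy : trans (.tm M σ h) .eval y ≠ 0) :
    ∃ V hV h', y = .val V σ hV h' ∧ sem M V ≠ 0 := by
  cases y with
  | tm N τ h' =>
    refine absurd ?_ hy
    simp only [trans, ite_eq_right_iff]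
    rintro ⟨⟩
  | val V τ hV h' =>
    simp only [trans, ne_eq, ite_eq_right_iff, Classical.not_imp] at hy
    obtain ⟨rfl, hy⟩ := hy
    exact ⟨V, hV, h', rfl, hy⟩

/-- Application is a deterministic transition, so the only possible match for the contractum on the
left is the contractum on the right. -/
theorem IsProbSimulation.exists_beta {R : State S → State S → Prop}
    (hR : IsProbSimulation PCFL.trans R) {P Q W : Term S} {τ θ : Ty} {hP : IsValue (.lam P)}
    {hQ : IsValue (.lam Q)} {h h'} (hPQ : R (.val (.lam P) (.arrow τ θ) hP h)
      (.val (.lam Q) (.arrow τ θ) hQ h')) (hW : IsValue W) (hWτ : Typed [] W τ)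
    (hPW : Typed [] (P.inst W) θ) : ∃ hQW, R (.tm (P.inst W) θ hPW) (.tm (Q.inst W) θ hQW) := by
  have hne : PCFL.trans (.val (.lam P) (.arrow τ θ) hP h) (.val W hW) (.tm (P.inst W) θ hPW) ≠ 0 := by
    simp only [PCFL.trans]
    rw [if_pos (.lam hWτ)]
    exact one_ne_zero
  obtain ⟨y, hy, hne⟩ := hR.exists_of_ne_zero hPQ _ _ hne
  simp only [PCFL.trans, ne_eq, ite_eq_right_iff, one_ne_zero, imp_false, not_not] at hne
  cases hne
  exact ⟨_, hy⟩

theorem IsProbSimulation.exists_eval {R : State S → State S → Prop}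
    (hR : IsProbSimulation PCFL.trans R) {M N V : Term S} {σ : Ty} {hM : Typed [] M σ}
    {hN : Typed [] N σ} (hMN : R (.tm M σ hM) (.tm N σ hN)) (hV : IsValue V)
    (hVσ : Typed [] V σ) (h0 : sem M V ≠ 0) :
    ∃ W hW hWσ, R (.val V σ hV hVσ) (.val W σ hW hWσ) ∧ sem N W ≠ 0 := by
  obtain ⟨y, hy, hne⟩ := hR.exists_of_ne_zero hMN .eval (.val V σ hV hVσ)
    (by rwa [trans_eval_val])
  obtain ⟨W, hW, hWσ, rfl, hNW⟩ := exists_of_trans_eval_ne_zero hne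
  exact ⟨W, hW, hWσ, hy, hNW⟩

theorem IsProbSimulation.sem_le {R : State S → State S → Prop}
    (hR : IsProbSimulation PCFL.trans R) {M N V W : Term S} {σ : Ty} {hM : Typed [] M σ}
    {hN : Typed [] N σ} (hMN : R (.tm M σ hM) (.tm N σ hN)) (hV : IsValue V)
    (hVσ : Typed [] V σ) (hW : IsValue W) (hWσ : Typed [] W σ)
    (hu : ∀ U hU hUσ, R (.val V σ hV hVσ) (.val U σ hU hUσ) → sem N U ≠ 0 → U = W) :
    sem M V ≤ sem N W := by
  have h := hR.le_of_unique hMN .eval (.val V σ hV hVσ) (.val W σ hW hWσ) fun z hz h0 => by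
    obtain ⟨U, hU, hUσ, rfl, hne⟩ := exists_of_trans_eval_ne_zero h0
    obtain rfl := hu U hU hUσ hz hne
    rfl
  rwa [trans_eval_val, trans_eval_val] at h

theorem sem_lam_self_ne_zero (P : Term S) : sem (.lam P) (.lam P) ≠ 0 := by
  refine ne_of_gt (lt_of_lt_of_le ?_ (dirac_le_sem (.lam P) (.lam P)))
  simp [dirac]

theorem sem_lam_ne_zero {P V : Term S} (h : sem (.lam P) V ≠ 0) : V = .lam P :=
  dirac_ne_zero fun h0 => h (le_antisymm ((sem_lam_le P V).trans h0.le) zero_le)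

theorem Omega_ne_I : (Omega : Term S) ≠ I := by
  intro h
  cases h

theorem sem_lam_self (P : Term S) : 1 ≤ sem (.lam P) (.lam P) := by
  simpa [dirac] using dirac_le_sem (.lam P) (.lam P)

theorem not_appSimilar_termM_termN : ¬ AppSimilar tyMN (termM : Term S) termN := by
  rintro ⟨hM, hN, R, hR, h⟩
  obtain ⟨V, hV, hVσ, h, hne⟩ := hR.exists_eval h (.lam _) typed_termM (sem_lam_self_ne_zero _)
  obtain rfl := sem_lam_ne_zero hne
  obtain ⟨hQ, h⟩ := hR.exists_beta h (.bool true) .bool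
    (show Typed [] flipper _ from .lam (.choice typed_Omega typed_I))
  -- Otherwise `λy. I` would be the only value of the choice above `flipper`, and its mass 1/2 would
  -- have to dominate 1.
  have hΩ : R (.val flipper (.arrow .bool (.arrow .bool .bool)) (.lam _)
      (.lam (.choice typed_Omega typed_I))) 
      (.val (.lam Omega) (.arrow .bool (.arrow .bool .bool)) (.lam _) (.lam typed_Omega)) := by
    by_contra hn
    have hle := hR.sem_le h (.lam _) (.lam (.choice typed_Omega typed_I)) (W := .lam I)
      (.lam _) (.lam typed_I) fun U hU hUσ hRU h0 => by
        by_contra hUI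
        refine h0 (le_antisymm ((sem_choice_lam_le Omega I U).trans ?_) zero_le)
        have hUΩ : U ≠ .lam Omega := by
          rintro rfl
          exact hn hRU
        simp [dirac, hUI, hUΩ]
    have hlt : (1 : ℝ≥0∞) ≤ 2⁻¹ := by
      refine (sem_lam_self _).trans (hle.trans ((sem_choice_lam_le Omega I _).trans ?_))
      simp [dirac, Omega_ne_I.symm]
    exact absurd hlt (by simp)
  obtain ⟨hQ', h⟩ := hR.exists_beta hΩ (.bool true) .bool
    (show Typed [] (.choice Omega I) _ from .choice typed_Omega typed_I)
  -- `Omega ⊕ I` returns `I` with positive probability, which `Omega` cannot match.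
  obtain ⟨W, hW, hWσ, -, hne⟩ := hR.exists_eval (V := I) h (.lam _) typed_I
    (ne_of_gt (lt_of_lt_of_le (by simp [dirac, I]) (le_sem_choice_Omega_lam (.var 0) I)))
  exact hne (sem_Omega W)

theorem not_appSimilar_termN_termM : ¬ AppSimilar tyMN (termN : Term S) termM := by
  rintro ⟨hN, hM, R, hR, h⟩
  obtain ⟨V, hV, hVσ, h, hne⟩ := hR.exists_eval h (.lam _) typed_termN (sem_lam_self_ne_zero _)
  obtain rfl := sem_lam_ne_zero hne
  obtain ⟨hQ, h⟩ := hR.exists_beta h (.bool true) .bool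
    (show Typed [] (.choice (.lam Omega) (.lam I)) _ from
      .choice (.lam typed_Omega) (.lam typed_I))
  obtain ⟨W, hW, hWσ, h, hne⟩ := hR.exists_eval (V := .lam I) h (.lam _) (.lam typed_I)
    (ne_of_gt (lt_of_lt_of_le (by simp [dirac]) (le_sem_choice_lam Omega I (.lam I))))
  obtain rfl := sem_lam_ne_zero hne
  obtain ⟨hQ', h⟩ := hR.exists_beta h (.bool true) .bool (show Typed [] I _ from typed_I)
  -- `I` evaluates to itself with probability 1, and `I` is also the only value of `Omega ⊕ I`, of
  -- mass 1/2.
  have hle := hR.sem_le (V := I) h (.lam _) typed_I (.lam (.var 0)) typed_I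
    fun U hU hUσ hRU h0 => dirac_ne_zero fun hU0 =>
      h0 (le_antisymm ((sem_choice_Omega_lam_le (.var 0) U).trans (by simp [hU0])) zero_le)
  have hlt : (1 : ℝ≥0∞) ≤ 2⁻¹ := by
    refine (sem_lam_self _).trans (hle.trans ((sem_choice_Omega_lam_le (.var 0) _).trans ?_))
    simp [dirac]
  exact absurd hlt (by simp)

theorem isClosure_nil (ξ : ℕ → Term S) : IsClosure [] ξ := by
  intro i τ h
  simp at h

theorem not_simPreorder_termM_termN : ¬ SimPreorder [] tyMN (termM : Term S) termN :=
  fun h => not_appSimilar_termM_termN (h.2.2 .var (isClosure_nil _))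

theorem not_simPreorder_termN_termM : ¬ SimPreorder [] tyMN (termN : Term S) termM :=
  fun h => not_appSimilar_termN_termM (h.2.2 .var (isClosure_nil _))

end PCFL

theorem mainTheorem3 (S : PCFL.OpSig) :
    (PCFL.Typed [] (PCFL.termM : PCFL.Term S) PCFL.tyMN ∧
      PCFL.Typed [] (PCFL.termN : PCFL.Term S) PCFL.tyMN) ∧
    (¬ PCFL.SimPreorder [] PCFL.tyMN (PCFL.termM : PCFL.Term S) PCFL.termN ∧
      ¬ PCFL.SimPreorder [] PCFL.tyMN (PCFL.termN : PCFL.Term S) PCFL.termM) ∧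
    PCFL.CtxPreorder [] PCFL.tyMN (PCFL.termM : PCFL.Term S) PCFL.termN ∧
    ¬ (∀ (Γ : List PCFL.Ty) (σ : PCFL.Ty) (P Q : PCFL.Term S),
        PCFL.SimPreorder Γ σ P Q ↔ PCFL.CtxPreorder Γ σ P Q) :=
  ⟨⟨PCFL.typed_termM, PCFL.typed_termN⟩,
    ⟨PCFL.not_simPreorder_termM_termN, PCFL.not_simPreorder_termN_termM⟩,
    PCFL.ctxPreorder_termM_termN, fun h =>
      PCFL.not_simPreorder_termM_termN ((h _ _ _ _).2 PCFL.ctxPreorder_termM_termN)⟩
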